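/- **Setting.** Let $\mathbb K$ be an algebraic closure of $\mathbb C(q)$, with fixed square roots $q^{1/2}$ of $q$ and $c=[2]_{q^{1/2}}^{1/2}$ of $q^{1/2}+q^{-1/2}$. Let $A=(a_{ij})_{i,j\in I}$, $I=\{0,1,\dots,n\}$, be the affine Cartan matrix of type $A^{(1)}_n$ ($n\ge1$), $B^{(1)}_n$ ($n\ge2$), $C^{(1)}_n$ ($n\ge1$) or $D^{(1)}_n$ ($n\ge3$) in the standard labelling, i.e. of $\widehat{\mathfrak{sl}}_{N}$, $\widehat{\mathfrak{so}}_{N}$, $\widehat{\mathfrak{sp}}_{N}$, $\widehat{\mathfrak{so}}_{N}$ with $N=n+1,\ 2n+1,\ 2n,\ 2n$ respectively. Put $d_i=1$, except $d_n=\frac12$ in type $B$ and $d_0=d_n=2$ in type $C$; so $d_ia_{ij}=d_ja_{ji}$. Put $q_i=q^{d_i}$, let $Q=\bigoplus_{i\in I}\mathbb Z\alpha_i$ with $(\alpha_i,\alpha_j)=d_ia_{ij}$, and let $W$ be the Weyl group generated by $r_i(\alpha_j)=\alpha_j-a_{ij}\alpha_i$. $U_q(\mathfrak g)$ is the unital $\mathbb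 K$-algebra with generators $x_i,y_i,k_i^{\pm1}$ ($i\in I$) and relations $k_ik_j=k_jk_i$, $k_ix_j=q_i^{a_{ij}}x_jk_i$, $k_iy_j=q_i^{-a_{ij}}y_jk_i$, $[x_i,y_j]=\delta_{ij}\frac{k_i-k_i^{-1}}{q_i-q_i^{-1}}$ and, for $i\ne j$, the quantum Serre relations $\sum_{r=0}^{1-a_{ij}}(-1)^rx_i^{(1-a_{ij}-r)}x_jx_i^{(r)}=0=\sum_{r=0}^{1-a_{ij}}(-1)^ry_i^{(1-a_{ij}-r)}y_jy_i^{(r)}$, with divided powers $x_i^{(r)}=x_i^r/[r]_{q_i}!$, $y_i^{(r)}=y_i^r/[r]_{q_i}!$. Its antipode is the algebra anti-automorphism $S$ with $S(x_i)=-k_i^{-1}x_i$, $S(y_i)=-y_ik_i$, $S(k_i)=k_i^{-1}$. For $\chi\in\mathrm{Hom}(Q,\mathbb K^\times)$ let $\mathrm{Ad}(\chi)$ be the algebra automorphism $x_i\mapsto\chi(\alpha_i)x_i$, $y_i\mapsto\chi(\alpha_i)^{-1}y_i$, $k_i\mapsto k_i$. Let $U_q(\mathfrak h)$ be the subalgebra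 generated by the $k_i^{\pm1}$. **Vector representation.** Label the standard basis of $\mathbb K^N$ by $1,\dots,N$ (type $A$), by $-n,\dots,n$ (type $B$), or by $-n,\dots,-1,1,\dots,n$ (types $C$, $D$). Let $E_{ij}$ be the elementary matrices; in types $B,C,D$ put $F_{ij}=E_{ij}-\vartheta_i\vartheta_jE_{-j,-i}$, where $\vartheta_i=\operatorname{sgn}(i)$ in type $C$ and $\vartheta_i=1$ in types $B$, $D$; put $\bar\imath=n+1-i$. The representation $T_u$ is as follows. - Type $A$: $x_i\mapsto E_{i,i+1}$, $y_i\mapsto E_{i+1,i}$, $k_i\mapsto q^{E_{ii}-E_{i+1,i+1}}$ for $1\le i\le n$; $x_0\mapsto uE_{N1}$, $y_0\mapsto u^{-1}E_{1N}$, $k_0\mapsto q^{E_{NN}-E_{11}}$. - Types $B,C,D$, $1\le i<n$: $x_i\mapsto F_{-\bar\imath,-\bar\imath+1}$, $y_i\mapsto F_{-\bar\imath+1,-\bar\imath}$, $k_i\mapsto q^{F_{\bar\imath-1,\bar\imath-1}-F_{\bar\imath\bar\imath}}$. - $(x_n,y_n,k_n)\mapsto\big(c(E_{-1,0}-q^{-1/2}E_{01}),\,c(E_{0,-1}-q^{1/2}E_{10}),\,q^{-F_{11}}\big)$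 in type $B$; $\big(\tfrac12F_{-1,1},\tfrac12F_{1,-1},q^{-2F_{11}}\big)$ in type $C$; $\big(F_{-2,1},F_{1,-2},q^{-F_{11}-F_{22}}\big)$ in type $D$. - $(x_0,y_0,k_0)\mapsto\big(uF_{n-1,-n},\,u^{-1}F_{-n,n-1},\,q^{F_{n-1,n-1}+F_{nn}}\big)$ in types $B$, $D$; $\big(\tfrac12uF_{n,-n},\tfrac12u^{-1}F_{-n,n},q^{2F_{nn}}\big)$ in type $C$. **Generalized Satake diagrams and the algebras $B_{\mathbf c,\mathbf s}$.** Let $X\subseteq I$ with $A_X$ of finite type, let $w_X$ be the longest element of $W_X=\langle r_i\rangle_{i\in X}$, and let $\tau$ be a permutation of $I$ with $\tau^2=1$ and $a_{\tau(i)\tau(j)}=a_{ij}$, acting on $Q$ by $\alpha_i\mapsto\alpha_{\tau(i)}$. Put $\theta=-w_X\tau$ on $Q$. The pair $(X,\tau)$ is in $\mathrm{GSat}(A)$ if $-w_X(\alpha_i)=\alpha_{\tau(i)}$ for all $i\in X$, and if for all $i\in X$, $j\in I\setminus X$: $\theta(\alpha_j)=-(\alpha_i+\alpha_j)$ implies $a_{ji}\ne-1$.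 Choose $I^*\subseteq I\setminus X$ containing exactly one element of each $\tau$-orbit in $I\setminus X$. Let $I_{\rm diff}=\{j\in I^*: j\ne\tau(j),\ (\alpha_j,\theta(\alpha_j))\ne0\}$, $I_{\rm ns}=\{j\in I^*: j=\tau(j),\ a_{ij}=0\ \forall i\in X\}$ and $I_{\rm nsf}=\{j\in I_{\rm ns}: a_{ij}\in2\mathbb Z\ \forall i\in I_{\rm ns}\}$. Let $\mathcal C$ be the set of $\mathbf c\in(\mathbb K^\times)^{I\setminus X}$ such that for all $j\in I^*$: $c_j\ne c_{\tau(j)}$ implies $j\in I_{\rm diff}$. Let $\mathcal S$ be the set of $\mathbf s\in\mathbb K^{I\setminus X}$ such that for all $j\in I^*$: $s_j\ne0$ implies $j\in I_{\rm nsf}$. Let $T_i$ be Lusztig's automorphism $T''_{i,1}$ of $U_q(\mathfrak g)$: $T_i(x_i)=-y_ik_i$, $T_i(y_i)=-k_i^{-1}x_i$, $T_i(k_j)=k_jk_i^{-a_{ij}}$, and for $j\ne i$, $T_i(x_j)=\sum_{r=0}^{-a_{ij}}(-q_i)^{-r}x_i^{(-a_{ij}-r)}x_jx_i^{(r)}$,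 $T_i(y_j)=\sum_{r=0}^{-a_{ij}}(-q_i)^{r}y_i^{(r)}y_jy_i^{(-a_{ij}-r)}$. Let $T_{w_X}=T_{i_1}\cdots T_{i_\ell}$ for a reduced expression $w_X=r_{i_1}\cdots r_{i_\ell}$. Let $\omega_q(x_i)=-k_i^{-1}y_i$, $\omega_q(y_i)=-x_ik_i$, $\omega_q(k_i)=k_i^{-1}$, let $\tau$ permute the generators, and put $\theta_q=T_{w_X}\,\tau\,\omega_q$. Let $b_i=y_i$ for $i\in X$ and $b_i=y_i+c_i\theta_q(y_ik_i)k_i^{-1}-s_ik_i^{-1}$ for $i\in I\setminus X$. Then $B_{\mathbf c,\mathbf s}=B_{\mathbf c,\mathbf s}(X,\tau)\subseteq U_q(\mathfrak g)$ is the subalgebra generated by $\{x_i\}_{i\in X}$, by $U_q(\mathfrak h)^{\theta_q}=\{a\in U_q(\mathfrak h):\theta_q(a)=a\}$ and by $\{b_i\}_{i\in I}$. **Boundary intertwining equations.** Let $\mathcal B\subseteq U_q(\mathfrak g)$ be a subalgebra, $K(u)$ an $N\times N$ matrix over the field $\mathbb K(u)$ of rational functions and $\eta\in\mathbb K^\times$.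 The pair $(K(u),\eta)$ solves the *untwisted*, respectively *twisted*, boundary intertwining equation for $\mathcal B$ if for all $b\in\mathcal B$ $$K(u)\,T_{\eta u}(b)=T_{\eta/u}(b)\,K(u),\qquad\text{respectively}\qquad K(u)\,T_{\eta u}(b)=\big(T_{\eta/u}(S(b))\big)^{\rm t}\,K(u),$$ as an identity of matrix-valued rational functions of $u$. **Dressing.** Let $\eta\in\mathbb K^\times$; let $\boldsymbol\omega=(\omega_1,\dots,\omega_N)\in(\mathbb K^\times)^N$ with $\prod_{i=1}^N\omega_i=1$ in type $A$, and $\boldsymbol\omega=(\omega_1,\dots,\omega_n)\in(\mathbb K^\times)^n$ in types $B,C,D$. Put $G(\boldsymbol\omega)=\sum_{i=1}^N\omega_iE_{ii}$ in type $A$ and $G(\boldsymbol\omega)=\sum_{i=1}^n(\omega_iE_{-\bar\imath,-\bar\imath}+\omega_i^{-1}E_{\bar\imath\bar\imath})$, plus $E_{00}$ in type $B$, in types $B,C,D$. Define $\zeta=\zeta(\boldsymbol\omega,\eta)\in\mathrm{Hom}(Q,\mathbb K^\times)$ by $\zeta(\alpha_i)=\omega_i\omega_{i+1}^{-1}$ for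 $1\le i\le n-1$; $\zeta(\alpha_n)=\omega_n\omega_{n+1}^{-1},\ \omega_n,\ \omega_n^2,\ \omega_{n-1}\omega_n$ in types $A,B,C,D$; and $\zeta(\alpha_0)=\eta\,\omega_1^{-1}\omega_N,\ \eta\,\omega_1^{-1}\omega_2^{-1},\ \eta\,\omega_1^{-2},\ \eta\,\omega_1^{-1}\omega_2^{-1}$ in types $A,B,C,D$. **Proposition.** Let $(X,\tau)\in\mathrm{GSat}(A)$, $\mathbf c\in\mathcal C$, $\mathbf s\in\mathcal S$, and let $\boldsymbol\omega$, $\eta$ be as above. For every $N\times N$ matrix $K(u)$ over $\mathbb K(u)$: 1. $\big(G(\boldsymbol\omega)^{-1}K(u)\,G(\boldsymbol\omega),\,\eta\big)$ solves the untwisted boundary intertwining equation for $B_{\mathbf c,\mathbf s}(X,\tau)$ if and only if $(K(u),1)$ solves the untwisted boundary intertwining equation for $\mathrm{Ad}(\zeta(\boldsymbol\omega,\eta))(B_{\mathbf c,\mathbf s}(X,\tau))$; 2. $\big(G(\boldsymbol\omega)\,K(u)\,G(\boldsymbol\omega),\,\eta\big)$ solves the twisted boundary intertwining equation for $B_{\mathbf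 c,\mathbf s}(X,\tau)$ if and only if $(K(u),1)$ solves the twisted boundary intertwining equation for $\mathrm{Ad}(\zeta(\boldsymbol\omega,\eta))(B_{\mathbf c,\mathbf s}(X,\tau))$. -/

import Mathlib

set_option linter.unusedSimpArgs false

namespace QAff

/-- The field `𝕂`, an algebraic closure of `ℂ(q)`. -/
def KK : Type := AlgebraicClosure (RatFunc ℂ)
noncomputable instance : Field KK := inferInstanceAs (Field (AlgebraicClosure (RatFunc ℂ)))
instance : IsAlgClosed KK := inferInstanceAs (IsAlgClosed (AlgebraicClosure (RatFunc ℂ)))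
noncomputable instance : Algebra (RatFunc ℂ) KK :=
  inferInstanceAs (Algebra (RatFunc ℂ) (AlgebraicClosure (RatFunc ℂ)))

/-- The indeterminate `q ∈ ℂ(q) ⊆ 𝕂`. -/
noncomputable def q : KK := algebraMap (RatFunc ℂ) KK RatFunc.X

theorem q_pow_ne_one (m : ℕ) (hm : m ≠ 0) : q ^ m ≠ 1 := by
  intro h
  have h1 : (RatFunc.X : RatFunc ℂ) ^ m = 1 := by
    apply (algebraMap (RatFunc ℂ) KK).injective
    simpa [q] using h
  have h2 : (Polynomial.X : Polynomial ℂ) ^ m = 1 := by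
    apply RatFunc.algebraMap_injective ℂ
    simpa using h1
  have h3 := congrArg Polynomial.natDegree h2
  simp at h3
  exact hm h3

theorem q_ne_zero : q ≠ 0 := by
  intro h
  have : (RatFunc.X : RatFunc ℂ) = 0 := by
    apply (algebraMap (RatFunc ℂ) KK).injective
    simpa [q] using h
  exact RatFunc.X_ne_zero this

/-- A fixed square root `q^{1/2}` of `q`. -/
noncomputable def qHalf : KK := (IsAlgClosed.exists_pow_nat_eq q (n := 2) (by norm_num)).choose

theorem qHalf_sq : qHalf ^ 2 = q :=
  (IsAlgClosed.exists_pow_nat_eq q (n := 2) (by norm_num)).choose_spec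

/-- A fixed square root `c` of `[2]_{q^{1/2}} = q^{1/2} + q^{-1/2}`. -/
noncomputable def cB : KK :=
  (IsAlgClosed.exists_pow_nat_eq (qHalf + qHalf⁻¹) (n := 2) (by norm_num)).choose

theorem cB_sq : cB ^ 2 = qHalf + qHalf⁻¹ :=
  (IsAlgClosed.exists_pow_nat_eq (qHalf + qHalf⁻¹) (n := 2) (by norm_num)).choose_spec

theorem qHalf_ne_zero : qHalf ≠ 0 := by
  intro h; apply q_ne_zero; rw [← qHalf_sq, h]; simp

theorem qHalf_pow_ne_one (m : ℕ) (hm : m ≠ 0) : qHalf ^ m ≠ 1 := by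
  intro h; apply q_pow_ne_one m hm; rw [← qHalf_sq, ← pow_mul, mul_comm, pow_mul, h, one_pow]

/-! ### Untwisted affine Cartan matrices of classical Lie type -/

inductive ClassicalType | A | B | C | D

def ClassicalType.minRank : ClassicalType → ℕ
  | .A => 1 | .B => 2 | .C => 1 | .D => 3

/-- One of the types `A_n^{(1)}` (`n ≥ 1`), `B_n^{(1)}` (`n ≥ 2`), `C_n^{(1)}` (`n ≥ 1`),
`D_n^{(1)}` (`n ≥ 3`). -/
structure AffineDatum where
  type : ClassicalType
  n : ℕ
  hn : type.minRank ≤ n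

/-- The index set `I = {0, 1, …, n}`. -/
abbrev AffineDatum.I (D : AffineDatum) : Type := Fin (D.n + 1)

/-- `A_n^{(1)}`: a cycle `0, 1, …, n` (for `n = 1` a double bond with `a_01 = a_10 = -2`). -/
def cartanA (n i j : ℤ) : ℤ :=
  if i = j then 2
  else if n = 1 then -2
  else if i + 1 = j ∨ j + 1 = i ∨ (i = 0 ∧ j = n) ∨ (i = n ∧ j = 0) then -1 else 0

/-- `B_n^{(1)}`: the chain `1, …, n` with short root `α_n`, and the node `0` joined to `2`. -/
def cartanB (n i j : ℤ) : ℤ :=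
  if i = j then 2
  else if (1 ≤ i ∧ i + 1 = j) ∨ (1 ≤ j ∧ j + 1 = i) ∨ (i = 0 ∧ j = 2) ∨ (i = 2 ∧ j = 0) then
    (if i = n then -2 else -1)
  else 0

/-- `C_n^{(1)}`: the chain `0, 1, …, n` with long roots `α_0` and `α_n`. -/
def cartanC (n i j : ℤ) : ℤ :=
  if i = j then 2
  else if i + 1 = j ∨ j + 1 = i then
    (if (i = 1 ∧ j = 0) ∨ (i = n - 1 ∧ j = n) then -2 else -1)
  else 0

/-- `D_n^{(1)}`: the chain `1, …, n - 1`, with the node `0` joined to `2` and `n` joined to `n - 2`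
(for `n = 3` the diagram is the cycle `0, 2, 1, 3`). -/
def adjD (n i j : ℤ) : Prop :=
  (1 ≤ i ∧ i + 1 = j ∧ j < n) ∨ (i = 0 ∧ j = 2) ∨ (i = n - 2 ∧ j = n) ∨ (n = 3 ∧ i = 0 ∧ j = 3)

instance (n i j : ℤ) : Decidable (adjD n i j) := by unfold adjD; infer_instance

def cartanD (n i j : ℤ) : ℤ :=
  if i = j then 2 else if adjD n i j ∨ adjD n j i then -1 else 0

/-- The Cartan matrix `a_ij`. -/
def AffineDatum.a (D : AffineDatum) (i j : D.I) : ℤ :=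
  match D.type with
  | .A => cartanA D.n i j
  | .B => cartanB D.n i j
  | .C => cartanC D.n i j
  | .D => cartanD D.n i j

/-- The integer `2 d_i`, where `d_i a_ij = d_j a_ji`. -/
def AffineDatum.twoD (D : AffineDatum) (i : D.I) : ℤ :=
  match D.type with
  | .A => 2
  | .B => if (i : ℕ) = D.n then 1 else 2
  | .C => if (i : ℕ) = 0 ∨ (i : ℕ) = D.n then 4 else 2
  | .D => 2

theorem AffineDatum.symm (D : AffineDatum) (i j : D.I) :
    D.twoD i * D.a i j = D.twoD j * D.a j i := by
  obtain ⟨t, n, hn⟩ := D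
  obtain ⟨i, hi⟩ := i
  obtain ⟨j, hj⟩ := j
  cases t <;> simp only [AffineDatum.a, AffineDatum.twoD] at *
  · unfold cartanA; grind (splits := 30)
  · unfold cartanB; grind (splits := 30)
  · unfold cartanC; grind (splits := 30)
  · unfold cartanD; grind (splits := 30)

/-- `q_i = q^{d_i}`. -/
noncomputable def AffineDatum.q (D : AffineDatum) (i : D.I) : KK := qHalf ^ D.twoD i

/-! ### The quantum group -/

/-- The generators `x_i`, `y_i`, `k_i`, `k_i⁻¹`. -/
inductive Gen (I : Type)
  | x (i : I) | y (i : I) | k (i : I) | kinv (i : I)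

/-- `[r]_z` -/
noncomputable def qInt (z : KK) (r : ℕ) : KK := (z ^ r - z⁻¹ ^ r) / (z - z⁻¹)

/-- `[r]_z!` -/
noncomputable def qFact (z : KK) (r : ℕ) : KK := ∏ m ∈ Finset.Icc 1 r, qInt z m

/-- The free algebra on the generators. -/
abbrev FreeU (D : AffineDatum) : Type := FreeAlgebra KK (Gen D.I)

/-- The quantum Serre expression `∑ (-1)^r X^{(m-r)} Y X^{(r)}`, divided powers with respect to `z`. -/
noncomputable def serre {A : Type} [Ring A] [Algebra KK A] (z : KK) (m : ℕ) (X Y : A) : A :=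
  ∑ r ∈ Finset.range (m + 1),
    ((-1) ^ r * (qFact z (m - r))⁻¹ * (qFact z r)⁻¹) • (X ^ (m - r) * Y * X ^ r)

namespace FreeU
variable {D : AffineDatum}
noncomputable def x (i : D.I) : FreeU D := FreeAlgebra.ι KK (.x i)
noncomputable def y (i : D.I) : FreeU D := FreeAlgebra.ι KK (.y i)
noncomputable def k (i : D.I) : FreeU D := FreeAlgebra.ι KK (.k i)
noncomputable def kinv (i : D.I) : FreeU D := FreeAlgebra.ι KK (.kinv i)
end FreeU
open FreeU

/-- The defining relations of `U_q(g)`. -/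
inductive Rel (D : AffineDatum) : FreeU D → FreeU D → Prop
  | k_kinv (i : D.I) : Rel D (k i * kinv i) 1
  | kinv_k (i : D.I) : Rel D (kinv i * k i) 1
  | k_k (i j : D.I) : Rel D (k i * k j) (k j * k i)
  | k_x (i j : D.I) : Rel D (k i * x j) ((D.q i ^ D.a i j) • (x j * k i))
  | k_y (i j : D.I) : Rel D (k i * y j) ((D.q i ^ (-D.a i j)) • (y j * k i))
  | x_y_same (i : D.I) :
      Rel D (x i * y i - y i * x i) ((D.q i - (D.q i)⁻¹)⁻¹ • (k i - kinv i))
  | x_y_ne (i j : D.I) (h : i ≠ j) : Rel D (x i * y j - y j * x i) 0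
  | serre_x (i j : D.I) (h : i ≠ j) : Rel D (serre (D.q i) (1 - D.a i j).toNat (x i) (x j)) 0
  | serre_y (i j : D.I) (h : i ≠ j) : Rel D (serre (D.q i) (1 - D.a i j).toNat (y i) (y j)) 0

/-- The Drinfeld-Jimbo quantum group `U_q(g)` over `𝕂`. -/
def Uq (D : AffineDatum) : Type := RingQuot (Rel D)
noncomputable instance (D : AffineDatum) : Ring (Uq D) := inferInstanceAs (Ring (RingQuot (Rel D)))
noncomputable instance (D : AffineDatum) : Algebra KK (Uq D) :=
  inferInstanceAs (Algebra KK (RingQuot (Rel D)))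

/-- The quotient map from the free algebra onto `U_q(g)`. -/
noncomputable def Uq.mk (D : AffineDatum) : FreeU D →ₐ[KK] Uq D := RingQuot.mkAlgHom KK (Rel D)

/-- The universal property of `U_q(g)`. -/
noncomputable def Uq.lift {D : AffineDatum} {A : Type} [Ring A] [Algebra KK A]
    (f : FreeU D →ₐ[KK] A) (hf : ∀ a b, Rel D a b → f a = f b) : Uq D →ₐ[KK] A :=
  RingQuot.liftAlgHom KK ⟨f, fun {a b} h => hf a b h⟩

theorem Uq.lift_mk {D : AffineDatum} {A : Type} [Ring A] [Algebra KK A]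
    (f : FreeU D →ₐ[KK] A) (hf : ∀ a b, Rel D a b → f a = f b) (a : FreeU D) :
    Uq.lift f hf (Uq.mk D a) = f a :=
  RingQuot.liftAlgHom_mkAlgHom_apply KK f _ a

theorem Uq.mk_rel {D : AffineDatum} {a b : FreeU D} (h : Rel D a b) : Uq.mk D a = Uq.mk D b :=
  RingQuot.mkAlgHom_rel KK h

theorem map_serre {A B : Type} [Ring A] [Algebra KK A] [Ring B] [Algebra KK B] (f : A →ₐ[KK] B)
    (z : KK) (m : ℕ) (X Y : A) : f (serre z m X Y) = serre z m (f X) (f Y) := by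
  simp [serre]

theorem serre_smul {A : Type} [Ring A] [Algebra KK A]
    (z : KK) (m : ℕ) (s t : KK) (X Y : A) :
    serre z m (s • X) (t • Y) = (s ^ m * t) • serre z m X Y := by
  simp only [serre, Finset.smul_sum]
  refine Finset.sum_congr rfl fun r hr => ?_
  have hr' : r ≤ m := by simpa [Nat.lt_succ_iff] using hr
  have : s ^ m = s ^ (m - r) * s ^ r := by rw [← pow_add]; congr 1; omega
  simp only [smul_pow, smul_mul_assoc, mul_smul_comm, smul_smul]
  rw [this]; congr 1; ring

/-- The algebra homomorphism with prescribed values on the generators. -/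
noncomputable def genLift {D : AffineDatum} {A : Type} [Ring A] [Algebra KK A]
    (fx fy fk fki : D.I → A) : FreeU D →ₐ[KK] A :=
  FreeAlgebra.lift KK fun g => match g with
    | .x i => fx i
    | .y i => fy i
    | .k i => fk i
    | .kinv i => fki i

section
variable {D : AffineDatum} {A : Type} [Ring A] [Algebra KK A] (fx fy fk fki : D.I → A) (i : D.I)
@[simp] theorem genLift_x : genLift fx fy fk fki (x i) = fx i := by simp [genLift, x]
@[simp] theorem genLift_y : genLift fx fy fk fki (y i) = fy i := by simp [genLift, y]
@[simp] theorem genLift_k : genLift fx fy fk fki (k i) = fk i := by simp [genLift, k]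
@[simp] theorem genLift_kinv : genLift fx fy fk fki (kinv i) = fki i := by simp [genLift, kinv]
end

theorem genLift_rel {D : AffineDatum} {A : Type} [Ring A] [Algebra KK A]
    (fx fy fk fki : D.I → A)
    (h1 : ∀ i, fk i * fki i = 1) (h2 : ∀ i, fki i * fk i = 1)
    (h3 : ∀ i j, fk i * fk j = fk j * fk i)
    (h4 : ∀ i j, fk i * fx j = (D.q i ^ D.a i j) • (fx j * fk i))
    (h5 : ∀ i j, fk i * fy j = (D.q i ^ (-D.a i j)) • (fy j * fk i))
    (h6 : ∀ i, fx i * fy i - fy i * fx i = (D.q i - (D.q i)⁻¹)⁻¹ • (fk i - fki i))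
    (h7 : ∀ i j, i ≠ j → fx i * fy j = fy j * fx i)
    (h8 : ∀ i j, i ≠ j → serre (D.q i) (1 - D.a i j).toNat (fx i) (fx j) = 0)
    (h9 : ∀ i j, i ≠ j → serre (D.q i) (1 - D.a i j).toNat (fy i) (fy j) = 0)
    (a b : FreeU D) (h : Rel D a b) : genLift fx fy fk fki a = genLift fx fy fk fki b := by
  cases h with
  | k_kinv i => simp [h1]
  | kinv_k i => simp [h2]
  | k_k i j => simp [h3 i j]
  | k_x i j => simp [h4 i j]
  | k_y i j => simp only [map_mul, map_smul, genLift_k, genLift_y, h5 i j]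
  | x_y_same i => simp [h6]
  | x_y_ne i j h => simp [h7 i j h]
  | serre_x i j h => simp [map_serre, h8 i j h]
  | serre_y i j h => simp [map_serre, h9 i j h]

section relations
variable (D : AffineDatum)
theorem Uq.k_kinv (i : D.I) : Uq.mk D (k i) * Uq.mk D (kinv i) = 1 := by
  simpa using Uq.mk_rel (Rel.k_kinv i)
theorem Uq.kinv_k (i : D.I) : Uq.mk D (kinv i) * Uq.mk D (k i) = 1 := by
  simpa using Uq.mk_rel (Rel.kinv_k i)
theorem Uq.k_k (i j : D.I) : Uq.mk D (k i) * Uq.mk D (k j) = Uq.mk D (k j) * Uq.mk D (k i) := by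
  simpa using Uq.mk_rel (Rel.k_k i j)
theorem Uq.k_x (i j : D.I) : Uq.mk D (k i) * Uq.mk D (x j) =
    (D.q i ^ D.a i j) • (Uq.mk D (x j) * Uq.mk D (k i)) := by
  simpa using Uq.mk_rel (Rel.k_x i j)
theorem Uq.k_y (i j : D.I) : Uq.mk D (k i) * Uq.mk D (y j) =
    (D.q i ^ (-D.a i j)) • (Uq.mk D (y j) * Uq.mk D (k i)) := by
  simpa only [map_mul, map_smul] using Uq.mk_rel (Rel.k_y i j)
theorem Uq.x_y_same (i : D.I) : Uq.mk D (x i) * Uq.mk D (y i) - Uq.mk D (y i) * Uq.mk D (x i) =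
    (D.q i - (D.q i)⁻¹)⁻¹ • (Uq.mk D (k i) - Uq.mk D (kinv i)) := by
  simpa using Uq.mk_rel (Rel.x_y_same i)
theorem Uq.x_y_ne (i j : D.I) (h : i ≠ j) :
    Uq.mk D (x i) * Uq.mk D (y j) = Uq.mk D (y j) * Uq.mk D (x i) := by
  have := Uq.mk_rel (Rel.x_y_ne i j h)
  rw [map_sub, map_mul, map_mul, map_zero] at this
  exact sub_eq_zero.mp this
theorem Uq.serre_x (i j : D.I) (h : i ≠ j) :
    serre (D.q i) (1 - D.a i j).toNat (Uq.mk D (x i)) (Uq.mk D (x j)) = 0 := by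
  simpa [map_serre] using Uq.mk_rel (Rel.serre_x i j h)
theorem Uq.serre_y (i j : D.I) (h : i ≠ j) :
    serre (D.q i) (1 - D.a i j).toNat (Uq.mk D (y i)) (Uq.mk D (y j)) = 0 := by
  simpa [map_serre] using Uq.mk_rel (Rel.serre_y i j h)
end relations

/-- `Ad(χ)` for a character `χ` of the root lattice, given by its values `χ(α_i)`:
`x_i ↦ χ(α_i) x_i`, `y_i ↦ χ(α_i)⁻¹ y_i`, `k_i ↦ k_i`. -/
noncomputable def Ad {D : AffineDatum} (χ : D.I → KKˣ) : Uq D →ₐ[KK] Uq D :=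
  Uq.lift (genLift (fun i => (χ i : KK) • Uq.mk D (x i)) (fun i => (χ i : KK)⁻¹ • Uq.mk D (y i))
      (fun i => Uq.mk D (k i)) (fun i => Uq.mk D (kinv i))) <| by
    apply genLift_rel
    · exact Uq.k_kinv D
    · exact Uq.kinv_k D
    · exact Uq.k_k D
    · intro i j
      rw [mul_smul_comm, Uq.k_x, smul_mul_assoc, smul_comm]
    · intro i j
      rw [mul_smul_comm, Uq.k_y, smul_mul_assoc, smul_comm]
    · intro i
      rw [← Uq.x_y_same]
      simp [smul_smul]
    · intro i j h
      rw [smul_mul_smul_comm, smul_mul_smul_comm, Uq.x_y_ne D i j h, mul_comm (χ i : KK)]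
    · intro i j h
      rw [serre_smul, Uq.serre_x D i j h, smul_zero]
    · intro i j h
      rw [serre_smul, Uq.serre_y D i j h, smul_zero]

/-! ### The antipode -/

section antipode
variable {A : Type} [Ring A] [Algebra KK A]

theorem pow_comm_smul {X g : A} {a : KK} (h : X * g = a • (g * X)) (r : ℕ) :
    X ^ r * g = a ^ r • (g * X ^ r) := by
  induction r with
  | zero => simp
  | succ r ih =>
    rw [pow_succ, mul_assoc, h, mul_smul_comm, ← mul_assoc, ih, smul_mul_assoc, smul_smul,
      mul_assoc, pow_succ]
    congr 1; ring

theorem comm_pow_smul {X g : A} {a : KK} (h : X * g = a • (g * X)) (r : ℕ) :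
    X * g ^ r = a ^ r • (g ^ r * X) := by
  induction r with
  | zero => simp
  | succ r ih =>
    rw [pow_succ, ← mul_assoc, ih, smul_mul_assoc, mul_assoc, h, mul_smul_comm, smul_smul,
      ← mul_assoc, pow_succ]

/-- `(gX)^r (hY) (gX)^s` depends on `(r, s)` only through `X^r Y X^s` and `r + s`. -/
theorem twist_aux {X Y g h : A} {a b : KK} (h1 : X * g = a • (g * X)) (h2 : X * h = b • (h * X))
    (h3 : Y * g = b • (g * Y)) (h4 : h * g = g * h) (r s : ℕ) :
    (g * X) ^ r * (h * Y) * (g * X) ^ s =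
      (a ^ ((r + s) * (r + s - 1) / 2) * b ^ (r + s)) • (g ^ (r + s) * h * (X ^ r * Y * X ^ s)) := by
  induction s with
  | zero =>
    induction r with
    | zero => simp
    | succ r ih =>
      simp only [pow_zero, mul_one, add_zero] at ih ⊢
      have h5 : X * (g ^ r * h) = (a ^ r * b) • (g ^ r * h * X) := by
        rw [← mul_assoc, comm_pow_smul h1, smul_mul_assoc, mul_assoc, h2, mul_smul_comm, smul_smul,
          mul_assoc]
      have : (r + 1) * (r + 1 - 1) / 2 = r * (r - 1) / 2 + r := by
        rw [← Finset.sum_range_id_mul_two, ← Finset.sum_range_id_mul_two, Finset.sum_range_succ]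
        simp
      rw [pow_succ', mul_assoc, ih, mul_smul_comm, mul_assoc g X, ← mul_assoc X, h5, this]
      simp only [smul_mul_assoc, mul_smul_comm, smul_smul]
      congr 1
      · ring
      · rw [pow_succ', pow_succ']; simp only [mul_assoc]
  | succ s ih =>
    have h5 : (X ^ r * Y * X ^ s) * g = (a ^ (r + s) * b) • (g * (X ^ r * Y * X ^ s)) := by
      rw [mul_assoc, pow_comm_smul h1, mul_smul_comm, mul_assoc, ← mul_assoc Y, h3]
      simp only [smul_mul_assoc, mul_smul_comm, smul_smul]
      rw [mul_assoc g, ← mul_assoc (X ^ r), pow_comm_smul h1]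
      simp only [smul_mul_assoc, smul_smul, mul_assoc]
      congr 1; ring
    have : (r + (s + 1)) * (r + (s + 1) - 1) / 2 = (r + s) * (r + s - 1) / 2 + (r + s) := by
      rw [← add_assoc, ← Finset.sum_range_id_mul_two, ← Finset.sum_range_id_mul_two,
        Finset.sum_range_succ]
      simp
    have hc : h * g ^ 1 = g ^ 1 * h := by simpa using h4
    rw [pow_succ, ← mul_assoc, ih, smul_mul_assoc, mul_assoc, ← mul_assoc _ g X, h5, this]
    simp only [smul_mul_assoc, mul_smul_comm, smul_smul]
    congr 1
    · ring
    · rw [← mul_assoc _ _ X, ← mul_assoc _ g, mul_assoc _ h g, h4, ← mul_assoc _ g h, ← pow_succ,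
        pow_succ X s, add_assoc]
      simp only [mul_assoc]

theorem serre_twist {X Y g h : A} {a b : KK} (h1 : X * g = a • (g * X)) (h2 : X * h = b • (h * X))
    (h3 : Y * g = b • (g * Y)) (h4 : h * g = g * h) (z : KK) (m : ℕ) (hs : serre z m X Y = 0) :
    serre z m (g * X) (h * Y) = 0 := by
  have : serre z m (g * X) (h * Y) =
      (a ^ (m * (m - 1) / 2) * b ^ m) • (g ^ m * h * serre z m X Y) := by
    simp only [serre, Finset.mul_sum, Finset.smul_sum]
    refine Finset.sum_congr rfl fun r hr => ?_
    have hr' : m - r + r = m := by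
      have : r ≤ m := by simpa [Nat.lt_succ_iff] using hr
      omega
    rw [twist_aux h1 h2 h3 h4, hr', mul_smul_comm, smul_comm]
  rw [this, hs, mul_zero, smul_zero]

/-- the quantum Serre expression read backwards -/
theorem serre_op (z : KK) (m : ℕ) (X Y : A) :
    serre z m (MulOpposite.op X) (MulOpposite.op Y) =
      MulOpposite.op ((-1 : KK) ^ m • serre z m X Y) := by
  apply MulOpposite.unop_injective
  simp only [serre, MulOpposite.unop_op, Finset.smul_sum]
  rw [Finset.unop_sum, ← Finset.sum_range_reflect]
  refine Finset.sum_congr rfl fun r hr => ?_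
  have hr' : r ≤ m := by simpa [Nat.lt_succ_iff] using hr
  have e1 : m + 1 - 1 - r = m - r := by omega
  have e2 : m - (m - r) = r := by omega
  rw [e1, e2]
  simp only [MulOpposite.unop_smul, MulOpposite.unop_mul, MulOpposite.unop_pow,
    MulOpposite.unop_op, smul_smul, mul_assoc]
  congr 1
  have : ((-1 : KK)) ^ m = (-1) ^ (m - r) * (-1) ^ r := by rw [← pow_add]; congr 1; omega
  rw [this]
  have h2 : ((-1 : KK) ^ r) * (-1) ^ r = 1 := by rw [← mul_pow]; simp
  linear_combination (-(-1 : KK) ^ (m - r) * (qFact z r)⁻¹ * (qFact z (m - r))⁻¹) * h2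
end antipode

variable {D : AffineDatum}

theorem qHalf_zpow_ne (i : D.I) : D.q i ≠ 0 := zpow_ne_zero _ qHalf_ne_zero

theorem q_pow_symm (i j : D.I) : D.q i ^ D.a i j = D.q j ^ D.a j i := by
  simp only [AffineDatum.q, ← _root_.zpow_mul, D.symm i j]

theorem x_kinv (i j : D.I) : Uq.mk D (x j) * Uq.mk D (kinv i) =
    (D.q i ^ D.a i j) • (Uq.mk D (kinv i) * Uq.mk D (x j)) := by
  calc Uq.mk D (x j) * Uq.mk D (kinv i)
      = Uq.mk D (kinv i) * (Uq.mk D (k i) * Uq.mk D (x j)) * Uq.mk D (kinv i) := by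
        rw [← mul_assoc (Uq.mk D (kinv i)), Uq.kinv_k, one_mul]
    _ = _ := by
        rw [Uq.k_x, mul_smul_comm, smul_mul_assoc, mul_assoc, mul_assoc (Uq.mk D (x j)),
          Uq.k_kinv, mul_one]

theorem y_k (i j : D.I) : Uq.mk D (y j) * Uq.mk D (k i) =
    (D.q i ^ D.a i j) • (Uq.mk D (k i) * Uq.mk D (y j)) := by
  rw [Uq.k_y, smul_smul, ← zpow_add₀ (qHalf_zpow_ne i)]
  simp

theorem kinv_y (i j : D.I) : Uq.mk D (y j) * Uq.mk D (kinv i) =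
    (D.q i ^ (-D.a i j)) • (Uq.mk D (kinv i) * Uq.mk D (y j)) := by
  calc Uq.mk D (y j) * Uq.mk D (kinv i)
      = Uq.mk D (kinv i) * (Uq.mk D (k i) * Uq.mk D (y j)) * Uq.mk D (kinv i) := by
        rw [← mul_assoc (Uq.mk D (kinv i)), Uq.kinv_k, one_mul]
    _ = _ := by
        rw [Uq.k_y, mul_smul_comm, smul_mul_assoc, mul_assoc, mul_assoc (Uq.mk D (y j)),
          Uq.k_kinv, mul_one]

theorem kinv_kinv (i j : D.I) : Uq.mk D (kinv i) * Uq.mk D (kinv j) =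
    Uq.mk D (kinv j) * Uq.mk D (kinv i) := by
  have hi : IsUnit (Uq.mk D (k i)) := ⟨⟨_, _, Uq.k_kinv D i, Uq.kinv_k D i⟩, rfl⟩
  have hj : IsUnit (Uq.mk D (k j)) := ⟨⟨_, _, Uq.k_kinv D j, Uq.kinv_k D j⟩, rfl⟩
  apply hi.mul_left_cancel
  apply hj.mul_left_cancel
  rw [← mul_assoc (Uq.mk D (k i)), Uq.k_kinv, one_mul, Uq.k_kinv, ← mul_assoc, ← mul_assoc,
    ← Uq.k_k, mul_assoc (Uq.mk D (k i)), Uq.k_kinv, mul_one, Uq.k_kinv]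

theorem k_kinv_comm (i j : D.I) : Uq.mk D (k j) * Uq.mk D (kinv i) =
    Uq.mk D (kinv i) * Uq.mk D (k j) := by
  have hi : IsUnit (Uq.mk D (k i)) := ⟨⟨_, _, Uq.k_kinv D i, Uq.kinv_k D i⟩, rfl⟩
  apply hi.mul_left_cancel
  rw [← mul_assoc, Uq.k_k, mul_assoc, Uq.k_kinv, ← mul_assoc, Uq.k_kinv, mul_one, one_mul]

/-- The antipode, as an algebra homomorphism to the opposite algebra:
`S(x_i) = -k_i⁻¹ x_i`, `S(y_i) = -y_i k_i`, `S(k_i) = k_i⁻¹`. -/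
noncomputable def antipodeHom (D : AffineDatum) : Uq D →ₐ[KK] (Uq D)ᵐᵒᵖ :=
  Uq.lift (genLift
      (fun i => MulOpposite.op (-(Uq.mk D (kinv i) * Uq.mk D (x i))))
      (fun i => MulOpposite.op (-(Uq.mk D (y i) * Uq.mk D (k i))))
      (fun i => MulOpposite.op (Uq.mk D (kinv i)))
      (fun i => MulOpposite.op (Uq.mk D (k i)))) <| by
    apply genLift_rel
    · intro i; rw [← MulOpposite.op_mul, Uq.k_kinv, MulOpposite.op_one]
    · intro i; rw [← MulOpposite.op_mul, Uq.kinv_k, MulOpposite.op_one]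
    · intro i j; rw [← MulOpposite.op_mul, ← MulOpposite.op_mul, kinv_kinv]
    · intro i j
      rw [← MulOpposite.op_mul, ← MulOpposite.op_mul, ← MulOpposite.op_smul]
      congr 1
      rw [neg_mul, mul_neg, smul_neg, mul_assoc, x_kinv, mul_smul_comm, ← mul_assoc, kinv_kinv,
        mul_assoc]
    · intro i j
      rw [← MulOpposite.op_mul, ← MulOpposite.op_mul, ← MulOpposite.op_smul]
      congr 1
      rw [neg_mul, mul_neg, smul_neg, mul_assoc, k_kinv_comm i j, ← mul_assoc, kinv_y, smul_mul_assoc,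
        mul_assoc]
    · intro i
      rw [← MulOpposite.op_mul, ← MulOpposite.op_mul, ← MulOpposite.op_sub, ← MulOpposite.op_sub, ← MulOpposite.op_smul]
      congr 1
      have h1 : Uq.mk D (y i) * Uq.mk D (k i) * (Uq.mk D (kinv i) * Uq.mk D (x i)) =
          Uq.mk D (y i) * Uq.mk D (x i) := by
        rw [mul_assoc, ← mul_assoc (Uq.mk D (k i)), Uq.k_kinv, one_mul]
      have h2 : Uq.mk D (kinv i) * Uq.mk D (x i) * (Uq.mk D (y i) * Uq.mk D (k i)) =
          Uq.mk D (x i) * Uq.mk D (y i) := by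
        rw [y_k, mul_smul_comm, mul_assoc, ← mul_assoc (Uq.mk D (x i)), ← mul_assoc, ← mul_assoc]
        have h3 : Uq.mk D (x i) * Uq.mk D (k i) =
            (D.q i ^ (-D.a i i)) • (Uq.mk D (k i) * Uq.mk D (x i)) := by
          rw [Uq.k_x, smul_smul, ← zpow_add₀ (qHalf_zpow_ne i)]
          simp
        rw [mul_assoc (Uq.mk D (kinv i)), h3, mul_smul_comm, smul_mul_assoc, smul_smul,
          ← zpow_add₀ (qHalf_zpow_ne i), ← mul_assoc, Uq.kinv_k]
        simp
      rw [neg_mul_neg, neg_mul_neg, h1, h2, ← neg_sub, Uq.x_y_same, ← smul_neg, neg_sub]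
    · intro i j h
      rw [← MulOpposite.op_mul, ← MulOpposite.op_mul]
      congr 1
      have h3 : Uq.mk D (k j) * Uq.mk D (kinv i) = Uq.mk D (kinv i) * Uq.mk D (k j) :=
        k_kinv_comm i j
      rw [neg_mul_neg, neg_mul_neg, mul_assoc, ← mul_assoc (Uq.mk D (k j)), h3,
        mul_assoc (Uq.mk D (kinv i)), Uq.k_x, mul_smul_comm, mul_smul_comm, ← mul_assoc (Uq.mk D (y j)),
        kinv_y, smul_mul_assoc, smul_smul, _root_.zpow_neg, q_pow_symm j i,
        mul_inv_cancel₀ (zpow_ne_zero _ (qHalf_zpow_ne i)), one_smul, mul_assoc, mul_assoc,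
        ← mul_assoc (Uq.mk D (y j)), ← Uq.x_y_ne D i j h, mul_assoc]
    · intro i j h
      have e (i : D.I) : -(Uq.mk D (kinv i) * Uq.mk D (x i)) =
          (-1 : KK) • (Uq.mk D (kinv i) * Uq.mk D (x i)) := by simp
      rw [serre_op, e, e, serre_smul, serre_twist (x_kinv i i) (x_kinv j i |>.trans
        (by rw [q_pow_symm])) (x_kinv i j) (kinv_kinv j i) _ _ (Uq.serre_x D i j h)]
      simp
    · intro i j h
      have e (i : D.I) : -(Uq.mk D (y i) * Uq.mk D (k i)) =
          (-D.q i ^ D.a i i : KK) • (Uq.mk D (k i) * Uq.mk D (y i)) := by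
        rw [y_k, neg_smul]
      rw [serre_op, e, e, serre_smul, serre_twist (y_k i i) (y_k j i |>.trans
        (by rw [q_pow_symm])) (y_k i j) (Uq.k_k D j i) _ _ (Uq.serre_y D i j h)]
      simp

/-- The antipode `S : U_q(g) → U_q(g)` (an algebra anti-homomorphism). -/
noncomputable def antipode (D : AffineDatum) (a : Uq D) : Uq D := (antipodeHom D a).unop

/-! ### The vector representation `T_u` -/

/-- The field `𝕂(u)`. -/
abbrev KU : Type := RatFunc KK

/-- The labels `⟨N⟩` of the standard basis of `𝕂^N`. -/
noncomputable def AffineDatum.idx (D : AffineDatum) : Finset ℤ :=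
  match D.type with
  | .A => Finset.Icc 1 (D.n + 1)
  | .B => Finset.Icc (-D.n) D.n
  | .C => (Finset.Icc (-D.n) D.n : Finset ℤ).erase 0
  | .D => (Finset.Icc (-D.n) D.n : Finset ℤ).erase 0

/-- `N × N` matrices over `𝕂(u)`. -/
abbrev Mat (D : AffineDatum) : Type := Matrix D.idx D.idx KU

section mats
variable {D : AffineDatum}

/-- The elementary matrix `E_ab`. -/
noncomputable def E (a b : ℤ) : Mat D := Matrix.of fun r s => if (r : ℤ) = a ∧ (s : ℤ) = b then 1 else 0

/-- The signs `ϑ_a`, used in types B, C, D only. -/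
def AffineDatum.theta (D : AffineDatum) (a : ℤ) : ℤ :=
  match D.type with
  | .C => a.sign
  | _ => 1

/-- `F_ab = E_ab - ϑ_a ϑ_b E_{-b,-a}`. -/
noncomputable def F (a b : ℤ) : Mat D := E a b - (D.theta a * D.theta b) • E (-b) (-a)

/-- `q` to the power `∑ m_a E_aa`. -/
noncomputable def qDiag (m : ℤ → ℤ) : Mat D :=
  Matrix.diagonal fun r => algebraMap KK KU (q ^ m r)

/-- diagonal entries of `E_jj` -/
def eE (j : ℤ) : ℤ → ℤ := fun a => if a = j then 1 else 0
/-- diagonal entries of `F_jj = E_jj - E_{-j,-j}` -/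
def eF (j : ℤ) : ℤ → ℤ := fun a => (if a = j then 1 else 0) - (if a = -j then 1 else 0)
end mats

/-- The image of `x_i` under the vector representation `T_v`; `bar` is `n + 1 - i`. -/
noncomputable def xMat (D : AffineDatum) (v : KUˣ) (i : D.I) : Mat D :=
  let n : ℤ := D.n
  let bar : ℤ := n + 1 - (i : ℕ)
  match D.type with
  | .A => if (i : ℕ) = 0 then (v : KU) • E (n + 1) 1 else E (i : ℕ) ((i : ℕ) + 1)
  | .B => if (i : ℕ) = 0 then (v : KU) • F (n - 1) (-n)
      else if (i : ℕ) < D.n then F (-bar) (-bar + 1)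
      else algebraMap KK KU cB • (E (-1) 0 - algebraMap KK KU qHalf⁻¹ • E 0 1)
  | .C => if (i : ℕ) = 0 then ((1 / 2 : KU) * v) • F n (-n)
      else if (i : ℕ) < D.n then F (-bar) (-bar + 1)
      else (1 / 2 : KU) • F (-1) 1
  | .D => if (i : ℕ) = 0 then (v : KU) • F (n - 1) (-n)
      else if (i : ℕ) < D.n then F (-bar) (-bar + 1)
      else F (-2) 1

/-- The image of `y_i` under the vector representation `T_v`. -/
noncomputable def yMat (D : AffineDatum) (v : KUˣ) (i : D.I) : Mat D :=
  let n : ℤ := D.n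
  let bar : ℤ := n + 1 - (i : ℕ)
  match D.type with
  | .A => if (i : ℕ) = 0 then ((v⁻¹ : KUˣ) : KU) • E 1 (n + 1) else E ((i : ℕ) + 1) (i : ℕ)
  | .B => if (i : ℕ) = 0 then ((v⁻¹ : KUˣ) : KU) • F (-n) (n - 1)
      else if (i : ℕ) < D.n then F (-bar + 1) (-bar)
      else algebraMap KK KU cB • (E 0 (-1) - algebraMap KK KU qHalf • E 1 0)
  | .C => if (i : ℕ) = 0 then ((1 / 2 : KU) * ((v⁻¹ : KUˣ) : KU)) • F (-n) n
      else if (i : ℕ) < D.n then F (-bar + 1) (-bar)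
      else (1 / 2 : KU) • F 1 (-1)
  | .D => if (i : ℕ) = 0 then ((v⁻¹ : KUˣ) : KU) • F (-n) (n - 1)
      else if (i : ℕ) < D.n then F (-bar + 1) (-bar)
      else F 1 (-2)

/-- The image of `k_i` under the vector representation is `q` to the power of the diagonal matrix
with these entries. -/
def kExp (D : AffineDatum) (i : D.I) : ℤ → ℤ :=
  let n : ℤ := D.n
  let bar : ℤ := n + 1 - (i : ℕ)
  match D.type with
  | .A => if (i : ℕ) = 0 then eE (n + 1) - eE 1 else eE (i : ℕ) - eE ((i : ℕ) + 1)
  | .B => if (i : ℕ) = 0 then eF (n - 1) + eF n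
      else if (i : ℕ) < D.n then eF (bar - 1) - eF bar else -eF 1
  | .C => if (i : ℕ) = 0 then 2 * eF n
      else if (i : ℕ) < D.n then eF (bar - 1) - eF bar else -2 * eF 1
  | .D => if (i : ℕ) = 0 then eF (n - 1) + eF n
      else if (i : ℕ) < D.n then eF (bar - 1) - eF bar else -eF 1 - eF 2

/-! The remainder of this part verifies the defining relations of `U_q(g)`. -/

section proofs
instance : CharZero KK := charZero_of_injective_algebraMap (algebraMap (RatFunc ℂ) KK).injective
instance : CharZero KU := charZero_of_injective_algebraMap (algebraMap KK KU).injective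

theorem E_mul_E {D : AffineDatum} (a b c d : ℤ) :
    (E a b : Mat D) * E c d = if b = c ∧ b ∈ D.idx then E a d else 0 := by
  ext r s
  rw [Matrix.mul_apply]
  by_cases h : b = c ∧ b ∈ D.idx
  · rw [if_pos h, Finset.sum_eq_single ⟨b, h.2⟩]
    · simp only [E, Matrix.of_apply]
      grind
    · intro t _ ht
      have : (t : ℤ) ≠ b := fun e => ht (Subtype.ext e)
      simp [E, this]
    · simp
  · rw [if_neg h]
    refine Finset.sum_eq_zero fun t _ => ?_
    have := t.2
    simp only [E, Matrix.of_apply]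
    grind

theorem E_mul_zero {D : AffineDatum} {a b c d : ℤ} (h : b ≠ c) :
    (E a b : Mat D) * E c d = 0 := by
  rw [E_mul_E, if_neg (fun e => h e.1)]

/-- The positions of the nonzero entries of `x_i = α E_{ab} + β E_{a'b'}`. -/
structure Ent where
  (a b a' b' : ℤ)

/-- The positions of the entries of `x_i`. -/
def ent (D : AffineDatum) (i : ℤ) : Ent :=
  let n : ℤ := D.n
  let bar : ℤ := n + 1 - i
  match D.type with
  | .A => if i = 0 then ⟨n + 1, 1, n + 1, 1⟩ else ⟨i, i + 1, i, i + 1⟩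
  | .B => if i = 0 then ⟨n - 1, -n, n, -n + 1⟩ else if i < n then ⟨-bar, -bar + 1, bar - 1, bar⟩
      else ⟨-1, 0, 0, 1⟩
  | .C => if i = 0 then ⟨n, -n, n, -n⟩ else if i < n then ⟨-bar, -bar + 1, bar - 1, bar⟩
      else ⟨-1, 1, -1, 1⟩
  | .D => if i = 0 then ⟨n - 1, -n, n, -n + 1⟩ else if i < n then ⟨-bar, -bar + 1, bar - 1, bar⟩
      else ⟨-2, 1, -1, 2⟩

theorem theta_eq {D : AffineDatum} (h : D.type ≠ .C) (a : ℤ) : D.theta a = 1 := by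
  unfold AffineDatum.theta; cases hD : D.type <;> simp_all

theorem F_eq {D : AffineDatum} (h : D.type ≠ .C) (a b : ℤ) :
    (F a b : Mat D) = E a b - E (-b) (-a) := by
  simp [F, theta_eq h]

theorem F_eq_same {D : AffineDatum} (a b : ℤ) (h : 0 < a * b) :
    (F a b : Mat D) = E a b - E (-b) (-a) := by
  have : D.theta a * D.theta b = 1 := by
    unfold AffineDatum.theta
    cases hD : D.type <;> simp only [one_mul]
    rw [← Int.sign_mul, Int.sign_eq_one_of_pos h]
  simp [F, this]

theorem F_C {D : AffineDatum} (hD : D.type = .C) (a b : ℤ) (hab : a = -b) (hb : b ≠ 0) :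
    (F a b : Mat D) = (2 : KU) • E a b := by
  have : D.theta a * D.theta b = -1 := by
    subst hab
    simp only [AffineDatum.theta, hD]
    rw [Int.sign_neg, neg_mul, ← Int.sign_mul, Int.sign_eq_one_of_pos (mul_self_pos.mpr hb)]
  subst hab
  simp [F, this, two_smul]

theorem xy_ent (D : AffineDatum) (v : KUˣ) (i : D.I) :
    ∃ α β α' β' : KU,
      xMat D v i = α • E (ent D (i : ℕ)).a (ent D (i : ℕ)).b
        + β • E (ent D (i : ℕ)).a' (ent D (i : ℕ)).b' ∧
      yMat D v i = α' • E (ent D (i : ℕ)).b (ent D (i : ℕ)).a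
        + β' • E (ent D (i : ℕ)).b' (ent D (i : ℕ)).a' := by
  have hi : (i : ℕ) ≤ D.n := Nat.lt_succ_iff.mp i.2
  have hn := D.hn
  cases hD : D.type
  · simp only [xMat, yMat, ent, hD]
    split_ifs with h h' h' <;> try omega
    · exact ⟨v, 0, (v⁻¹ : KUˣ), 0, by simp, by simp⟩
    · exact ⟨1, 0, 1, 0, by simp, by simp⟩
  · have hC : D.type ≠ .C := by simp [hD]
    simp only [xMat, yMat, ent, hD, F_eq hC]
    split_ifs with h h' h1 h2 h3 h4 <;> try omega
    · refine ⟨v, -v, (v⁻¹ : KUˣ), -(v⁻¹ : KUˣ), ?_, ?_⟩ <;>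
        simp only [smul_add, smul_neg, smul_smul, neg_smul, sub_eq_add_neg, neg_neg] <;> ring_nf
    · refine ⟨1, -1, 1, -1, ?_, ?_⟩ <;>
        simp only [one_smul, neg_smul, sub_eq_add_neg] <;> ring_nf
    · refine ⟨algebraMap KK KU cB, -(algebraMap KK KU cB * algebraMap KK KU qHalf⁻¹),
        algebraMap KK KU cB, -(algebraMap KK KU cB * algebraMap KK KU qHalf), ?_, ?_⟩ <;>
        simp only [smul_add, smul_neg, smul_smul, neg_smul, sub_eq_add_neg]
  · simp only [xMat, yMat, ent, hD]
    have hn' : 1 ≤ D.n := by simpa [hD, ClassicalType.minRank] using hn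
    split_ifs with h h' h1 h2 h3 h4 <;> try omega
    · refine ⟨v, 0, (v⁻¹ : KUˣ), 0, ?_, ?_⟩ <;>
        rw [F_C hD _ _ (by omega) (by omega)] <;> simp [smul_smul, mul_right_comm _ _ (2 : KU)]
    · refine ⟨1, -1, 1, -1, ?_, ?_⟩ <;>
        rw [F_eq_same _ _ (by nlinarith)] <;>
        simp only [one_smul, neg_smul, sub_eq_add_neg] <;> ring_nf
    · refine ⟨1, 0, 1, 0, ?_, ?_⟩ <;>
        rw [F_C hD _ _ (by omega) (by omega)] <;> simp [smul_smul, mul_right_comm _ _ (2 : KU)]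
  · have hC : D.type ≠ .C := by simp [hD]
    simp only [xMat, yMat, ent, hD, F_eq hC]
    split_ifs with h h' h1 h2 h3 h4 <;> try omega
    · refine ⟨v, -v, (v⁻¹ : KUˣ), -(v⁻¹ : KUˣ), ?_, ?_⟩ <;>
        simp only [smul_add, smul_neg, smul_smul, neg_smul, sub_eq_add_neg, neg_neg] <;> ring_nf
    · refine ⟨1, -1, 1, -1, ?_, ?_⟩ <;>
        simp only [one_smul, neg_smul, sub_eq_add_neg] <;> ring_nf
    · refine ⟨1, -1, 1, -1, ?_, ?_⟩ <;>
        simp [sub_eq_add_neg]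

/-- The matrices with entries in these positions have product zero. -/
def NoProd (e f : Ent) : Prop := e.b ≠ f.a ∧ e.b ≠ f.a' ∧ e.b' ≠ f.a ∧ e.b' ≠ f.a'

theorem ent_sq (D : AffineDatum) (i : D.I) (h : D.type = .B → (i : ℕ) < D.n) :
    NoProd (ent D (i : ℕ)) (ent D (i : ℕ)) := by
  have hi : (i : ℕ) ≤ D.n := Nat.lt_succ_iff.mp i.2
  have hn := D.hn
  unfold NoProd
  cases hD : D.type <;> simp only [hD, ClassicalType.minRank, forall_const, reduceCtorEq,
      IsEmpty.forall_iff] at h hn <;> simp only [ent, hD] <;>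
    split_ifs <;> simp only <;> omega

/-- Pairs of end nodes whose generators commute although the products are nonzero. -/
def Special (D : AffineDatum) (i j : D.I) : Prop :=
  ((D.type = .B ∨ D.type = .D) ∧ (i : ℕ) = 0 ∧ (j : ℕ) = 1) ∨
  (D.type = .D ∧ (i : ℕ) = D.n - 1 ∧ (j : ℕ) = D.n)

end proofs

theorem noProd_mid_mid (p r : ℤ) (hp : 2 ≤ p) (hr : 2 ≤ r) (h1 : p + 1 ≠ r) (h2 : r + 1 ≠ p) :
    NoProd ⟨-p, -p + 1, p - 1, p⟩ ⟨-r, -r + 1, r - 1, r⟩ := by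
  refine ⟨?_, ?_, ?_, ?_⟩ <;> simp only <;> omega

theorem noProd_zero_mid (n r : ℤ) (hr : 2 ≤ r) (hn : r ≤ n) (h1 : r ≠ n) (h2 : r ≠ n - 1) :
    NoProd ⟨n - 1, -n, n, -n + 1⟩ ⟨-r, -r + 1, r - 1, r⟩ ∧
      NoProd ⟨-r, -r + 1, r - 1, r⟩ ⟨n - 1, -n, n, -n + 1⟩ := by
  refine ⟨⟨?_, ?_, ?_, ?_⟩, ?_, ?_, ?_, ?_⟩ <;> simp only <;> omega

theorem noProd_last_mid (r : ℤ) (hr : 2 ≤ r) (h1 : r ≠ 2) (h2 : r ≠ 3) :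
    NoProd ⟨-2, 1, -1, 2⟩ ⟨-r, -r + 1, r - 1, r⟩ ∧
      NoProd ⟨-r, -r + 1, r - 1, r⟩ ⟨-2, 1, -1, 2⟩ := by
  refine ⟨⟨?_, ?_, ?_, ?_⟩, ?_, ?_, ?_, ?_⟩ <;> simp only <;> omega

theorem noProd_zero_last (n : ℤ) (hn : 4 ≤ n) :
    NoProd ⟨n - 1, -n, n, -n + 1⟩ ⟨-2, 1, -1, 2⟩ ∧
      NoProd ⟨-2, 1, -1, 2⟩ ⟨n - 1, -n, n, -n + 1⟩ := by
  refine ⟨⟨?_, ?_, ?_, ?_⟩, ?_, ?_, ?_, ?_⟩ <;> simp only <;> omega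

theorem ent_comm_D (n i j : ℤ) (hn : 3 ≤ n) (hi0 : 0 ≤ i) (hj0 : 0 ≤ j) (hi : i ≤ n) (hj : j ≤ n)
    (hij : i ≠ j) (h : ¬ (adjD n i j ∨ adjD n j i))
    (h1 : ¬ (i = 0 ∧ j = 1)) (h2 : ¬ (j = 0 ∧ i = 1)) (h3 : ¬ (i = n - 1 ∧ j = n))
    (h4 : ¬ (j = n - 1 ∧ i = n)) :
    NoProd (if i = 0 then ⟨n - 1, -n, n, -n + 1⟩ else if i < n then
      ⟨-(n + 1 - i), -(n + 1 - i) + 1, (n + 1 - i) - 1, (n + 1 - i)⟩ else ⟨-2, 1, -1, 2⟩)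
      (if j = 0 then ⟨n - 1, -n, n, -n + 1⟩ else if j < n then
      ⟨-(n + 1 - j), -(n + 1 - j) + 1, (n + 1 - j) - 1, (n + 1 - j)⟩ else ⟨-2, 1, -1, 2⟩) := by
  obtain ⟨h, h'⟩ := not_or.mp h
  obtain ⟨b1, c⟩ := not_or.mp h
  obtain ⟨b2, c⟩ := not_or.mp c
  obtain ⟨b3, b4⟩ := not_or.mp c
  obtain ⟨d1, c'⟩ := not_or.mp h'
  obtain ⟨d2, c'⟩ := not_or.mp c'
  obtain ⟨d3, d4⟩ := not_or.mp c'
  clear h h' c c'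
  split_ifs with i0 j0 j1 i1 j0 j1 j0 j1
  · exact absurd (i0.trans j0.symm) hij
  · clear b3 b4 d1 d2 d3 d4 h3 h4 h2 b1
    refine (noProd_zero_mid _ _ ?_ ?_ ?_ ?_).1 <;> omega
  · clear d1 d2 d3 d4 b1 h1 h2 h3 h4 b2 b3
    refine (noProd_zero_last _ ?_).1; omega
  · clear b1 b2 b3 b4 d1 d3 d4 h1 h3 h4
    refine (noProd_zero_mid _ _ ?_ ?_ ?_ ?_).2 <;> omega
  · clear b2 b3 b4 d2 d3 d4 h1 h2 h3 h4
    refine noProd_mid_mid _ _ ?_ ?_ ?_ ?_ <;> omega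
  · clear b1 b2 b4 d1 d2 d3 d4 h1 h2 h4
    refine (noProd_last_mid _ ?_ ?_ ?_).2 <;> omega
  · clear b1 b2 b3 b4 d1 d2 d3 h1 h2 h3 h4
    refine (noProd_zero_last _ ?_).2; omega
  · clear b1 b2 b3 b4 d1 d2 d4 h1 h2 h3
    refine (noProd_last_mid _ ?_ ?_ ?_).1 <;> omega
  · clear b1 b2 b3 b4 d1 d2 d3 d4 h1 h2 h3 h4
    omega

theorem ent_comm (D : AffineDatum) (i j : D.I) (hij : i ≠ j) (h : D.a i j = 0)
    (hs : ¬ Special D i j) (hs' : ¬ Special D j i) :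
    NoProd (ent D (i : ℕ)) (ent D (j : ℕ)) := by
  have hi : (i : ℕ) ≤ D.n := Nat.lt_succ_iff.mp i.2
  have hj : (j : ℕ) ≤ D.n := Nat.lt_succ_iff.mp j.2
  have hn := D.hn
  have hij' : (i : ℕ) ≠ j := fun e => hij (Fin.ext e)
  by_cases hDD : D.type = .D
  · simp only [hDD, ClassicalType.minRank, AffineDatum.a, cartanD, Special, reduceCtorEq, false_or,
      or_true, true_and] at h hn hs hs'
    rw [if_neg (by omega)] at h
    have h' : ¬ (adjD D.n (i : ℕ) (j : ℕ) ∨ adjD D.n (j : ℕ) (i : ℕ)) := by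
      intro e; rw [if_pos e] at h; omega
    have := ent_comm_D D.n (i : ℕ) (j : ℕ) (by omega) (by omega) (by omega) (by omega) (by omega)
      (by omega) h' (fun e => hs (Or.inl ⟨by omega, by omega⟩))
      (fun e => hs' (Or.inl ⟨by omega, by omega⟩)) (fun e => hs (Or.inr ⟨by omega, by omega⟩))
      (fun e => hs' (Or.inr ⟨by omega, by omega⟩))
    simpa only [ent, hDD] using this
  simp only [NoProd, Special] at *
  clear hij
  cases hD : D.type <;>
    simp only [ent, hD, ClassicalType.minRank, AffineDatum.a, cartanA, cartanB, cartanC,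
      adjD, reduceCtorEq, true_or, or_true, true_and, false_and, or_false, false_or] at h hn hs hs' ⊢
  · split_ifs at h <;> split_ifs <;> simp only <;> omega
  · split_ifs at h <;> split_ifs <;> simp only <;> omega
  · split_ifs at h <;> split_ifs <;> simp only <;> omega
  · exact absurd hD hDD

/-- The product `e f e` of matrices with entries in these positions vanishes. -/
def Triple (e f : Ent) : Prop :=
  ((e.b ≠ f.a ∧ e.b' ≠ f.a) ∨ (f.b ≠ e.a ∧ f.b ≠ e.a')) ∧
  ((e.b ≠ f.a' ∧ e.b' ≠ f.a') ∨ (f.b' ≠ e.a ∧ f.b' ≠ e.a'))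

/-- The transposed positions. -/
def Ent.swap (e : Ent) : Ent := ⟨e.b, e.a, e.b', e.a'⟩

theorem NoProd.swap {e f : Ent} (h : NoProd e f) : NoProd f.swap e.swap := by
  simp only [NoProd, Ent.swap] at *; tauto

theorem Triple.swap {e f : Ent} (h : Triple e f) : Triple e.swap f.swap := by
  simp only [Triple, Ent.swap] at *; tauto

/-- The matrix `α E_{ab} + β E_{a'b'}`. -/
noncomputable def Ent.mat (D : AffineDatum) (e : Ent) (α β : KU) : Mat D :=
  α • E e.a e.b + β • E e.a' e.b'

theorem NoProd.mul_eq {D : AffineDatum} {e f : Ent} (h : NoProd e f) (α β γ δ : KU) :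
    e.mat D α β * f.mat D γ δ = 0 := by
  obtain ⟨h1, h2, h3, h4⟩ := h
  simp only [Ent.mat, mul_add, add_mul, smul_mul_assoc, mul_smul_comm, E_mul_zero h1,
    E_mul_zero h2, E_mul_zero h3, E_mul_zero h4, smul_zero, add_zero]

theorem Triple.mul_eq {D : AffineDatum} {e f : Ent} (h : Triple e f) (α β γ δ : KU) :
    e.mat D α β * f.mat D γ δ * e.mat D α β = 0 := by
  have e1 : e.mat D α β * E f.a f.b * e.mat D α β = 0 := by
    rcases h.1 with ⟨h1, h2⟩ | ⟨h1, h2⟩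
    · simp [Ent.mat, mul_add, add_mul, E_mul_zero h1, E_mul_zero h2]
    · simp [Ent.mat, mul_assoc, mul_add, add_mul, E_mul_zero h1, E_mul_zero h2]
  have e2 : e.mat D α β * E f.a' f.b' * e.mat D α β = 0 := by
    rcases h.2 with ⟨h1, h2⟩ | ⟨h1, h2⟩
    · simp [Ent.mat, mul_add, add_mul, E_mul_zero h1, E_mul_zero h2]
    · simp [Ent.mat, mul_assoc, mul_add, add_mul, E_mul_zero h1, E_mul_zero h2]
  conv_lhs => enter [1, 2]; unfold Ent.mat
  simp only [mul_add, add_mul, mul_smul_comm, smul_mul_assoc, e1, e2, smul_zero, add_zero]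

theorem serre_one {A : Type} [Ring A] [Algebra KK A] (z : KK) (X Y : A) (h : X * Y = Y * X) :
    serre z 1 X Y = 0 := by
  simp [serre, Finset.sum_range_succ, h, qFact]

theorem serre_two {A : Type} [Ring A] [Algebra KK A] (z : KK) (X Y : A) (h : X * X = 0)
    (h' : X * Y * X = 0) : serre z 2 X Y = 0 := by
  simp [serre, Finset.sum_range_succ, pow_two, h, h']

theorem serre_three {A : Type} [Ring A] [Algebra KK A] (z : KK) (X Y : A) (h : X * X * X = 0)
    (h1 : X * X * Y * X = 0) (h2 : X * Y * X * X = 0) : serre z 3 X Y = 0 := by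
  have h3 : X ^ 3 = 0 := by rw [pow_succ, pow_two, h]
  have h4 : X * Y * X ^ 2 = 0 := by rw [pow_two, ← mul_assoc, h2]
  simp [serre, Finset.sum_range_succ, h3, pow_two X, h1, ← mul_assoc, h2]

theorem ent_triple (D : AffineDatum) (i j : D.I) (h : D.a i j = -1) :
    Triple (ent D (i : ℕ)) (ent D (j : ℕ)) := by
  have hi : (i : ℕ) ≤ D.n := Nat.lt_succ_iff.mp i.2
  have hj : (j : ℕ) ≤ D.n := Nat.lt_succ_iff.mp j.2
  have hn := D.hn
  simp only [Triple]
  cases hD : D.type <;>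
    simp only [hD, ClassicalType.minRank, AffineDatum.a, cartanA, cartanB, cartanC, cartanD] at h hn
  · simp only [ent, hD]
    split_ifs at h <;> split_ifs <;> simp only <;> omega
  · simp only [ent, hD]
    split_ifs at h with h1 h2 h3
    · omega
    rcases h2 with h2 | h2 | h2 | h2 <;> split_ifs <;> simp only <;> omega
  · simp only [ent, hD]
    split_ifs at h with h1 h2 h3
    · omega
    rcases h2 with h2 | h2 <;> split_ifs <;> simp only <;> omega
  · simp only [ent, hD]
    split_ifs at h with h1 h2
    rcases h2 with (h2 | h2 | h2 | h2) | (h2 | h2 | h2 | h2) <;> split_ifs <;> simp only <;> omega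

section
variable {D : AffineDatum}

theorem special_aux (P R : ℤ) (hP : P ≠ 0) (hR : R ≠ 0) (h1 : P ≠ R) (h2 : P ≠ -R)
    (mP : P ∈ D.idx) (mP' : -P ∈ D.idx) (mR : R ∈ D.idx) (mR' : -R ∈ D.idx) (α β α' β' : KU)
    (X X' Y Y' : Mat D)
    (hX : X = α • (E P (-R) - E R (-P))) (hX' : X' = β • (E (-R) (-P) - E P R))
    (hY : Y = α' • (E (-R) P - E (-P) R)) (hY' : Y' = β' • (E (-P) (-R) - E R P)) :
    X * X' = X' * X ∧ X * Y' = Y' * X ∧ X' * Y = Y * X' ∧ Y * Y' = Y' * Y := by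
  have a1 : -P ≠ R := by omega
  have a2 : -R ≠ P := by omega
  have a3 : -P ≠ -R := by omega
  have a4 : -P ≠ P := by omega
  have a5 : -R ≠ R := by omega
  have b1 := a1.symm
  have b2 := a2.symm
  have b3 := a3.symm
  have b4 := a4.symm
  have b5 := a5.symm
  have b6 := h1.symm
  subst hX hX' hY hY'
  simp only [smul_mul_smul_comm, mul_sub, sub_mul, E_mul_E, mP, mP', mR, mR', and_true, true_and,
    a1, a2, a3, a4, a5, b1, b2, b3, b4, b5, b6, h1, h2, if_true, if_false, sub_zero, zero_sub,
    neg_sub]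
  rw [mul_comm α β, mul_comm α β', mul_comm β α', mul_comm α' β']
  refine ⟨?_, ?_, ?_, ?_⟩ <;> simp

theorem qDiag_mul_E (m : ℤ → ℤ) (a b : ℤ) :
    (qDiag m * E a b : Mat D) = algebraMap KK KU (q ^ m a) • E a b := by
  ext r s
  simp only [qDiag, Matrix.diagonal_mul, E, Matrix.of_apply, Matrix.smul_apply, smul_eq_mul]
  split_ifs with h
  · rw [h.1]
  · simp

theorem E_mul_qDiag (m : ℤ → ℤ) (a b : ℤ) :
    (E a b * qDiag m : Mat D) = algebraMap KK KU (q ^ m b) • E a b := by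
  ext r s
  simp only [qDiag, Matrix.mul_diagonal, E, Matrix.of_apply, Matrix.smul_apply, smul_eq_mul]
  split_ifs with h
  · rw [h.2]; ring
  · simp

theorem qDiag_mul (m m' : ℤ → ℤ) : (qDiag m * qDiag m' : Mat D) = qDiag (m + m') := by
  simp only [qDiag, Matrix.diagonal_mul_diagonal, ← map_mul, Pi.add_apply, zpow_add₀ q_ne_zero]

theorem qDiag_zero : (qDiag 0 : Mat D) = 1 := by simp [qDiag]
end

theorem kExp_wt (D : AffineDatum) (i j : D.I) :
    2 * (kExp D i (ent D (j : ℕ)).a - kExp D i (ent D (j : ℕ)).b) = D.twoD i * D.a i j ∧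
    2 * (kExp D i (ent D (j : ℕ)).a' - kExp D i (ent D (j : ℕ)).b') = D.twoD i * D.a i j := by
  have hi : (i : ℕ) ≤ D.n := Nat.lt_succ_iff.mp i.2
  have hj : (j : ℕ) ≤ D.n := Nat.lt_succ_iff.mp j.2
  have hn := D.hn
  cases hD : D.type <;>
    simp only [hD, ClassicalType.minRank, AffineDatum.a, AffineDatum.twoD, ent, kExp] at hn ⊢
  · generalize (i : ℕ) = i' at *
    generalize (j : ℕ) = j' at *
    generalize D.n = n at *
    unfold cartanA
    by_cases i0 : i' = 0 <;> by_cases j0 : j' = 0 <;>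
    simp only [i0, j0, if_true, if_false, eE, Pi.sub_apply, Nat.cast_zero, Nat.cast_eq_zero] <;>
    constructor <;> grind (splits := 30)
  · generalize (i : ℕ) = i' at *
    generalize (j : ℕ) = j' at *
    generalize D.n = n at *
    unfold cartanB
    by_cases i0 : i' = 0 <;> by_cases j0 : j' = 0 <;> by_cases i1 : i' < n <;>
    by_cases j1 : j' < n <;>
    simp only [i0, j0, i1, j1, if_true, if_false, eF, Pi.sub_apply, Pi.add_apply, Pi.neg_apply, Pi.mul_apply, Pi.ofNat_apply, Nat.cast_zero, Nat.cast_eq_zero, Nat.cast_lt] <;>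
    constructor <;> grind (splits := 40)
  · generalize (i : ℕ) = i' at *
    generalize (j : ℕ) = j' at *
    generalize D.n = n at *
    unfold cartanC
    by_cases i0 : i' = 0 <;> by_cases j0 : j' = 0 <;> by_cases i1 : i' < n <;>
    by_cases j1 : j' < n <;>
    simp only [i0, j0, i1, j1, if_true, if_false, eF, Pi.sub_apply, Pi.add_apply, Pi.neg_apply, Pi.mul_apply, Pi.ofNat_apply, Nat.cast_zero, Nat.cast_eq_zero, Nat.cast_lt] <;>
    constructor <;> grind (splits := 40)
  · generalize (i : ℕ) = i' at *
    generalize (j : ℕ) = j' at *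
    generalize D.n = n at *
    unfold cartanD adjD
    by_cases i0 : i' = 0 <;> by_cases j0 : j' = 0 <;> by_cases i1 : i' < n <;>
    by_cases j1 : j' < n <;>
    simp only [i0, j0, i1, j1, if_true, if_false, eF, Pi.sub_apply, Pi.add_apply, Pi.neg_apply, Pi.mul_apply, Pi.ofNat_apply, Nat.cast_zero, Nat.cast_eq_zero, Nat.cast_lt] <;>
    constructor <;> grind (splits := 40)

section
variable {D : AffineDatum}

theorem E_self (a : ℤ) : (E a a : Mat D) = Matrix.diagonal fun r : D.idx => ((eE a r : ℤ) : KU) := by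
  ext r s
  simp only [E, Matrix.of_apply, Matrix.diagonal_apply, eE]
  by_cases h : r = s
  · subst h; simp
  · have : (r : ℤ) ≠ s := fun e => h (Subtype.ext e)
    rw [if_neg h, if_neg (by omega)]

theorem comm_two {a b a' b' : ℤ} {α β α' β' : KU} (hα : α * α' = 1) (hβ : β * β' = 1)
    (ha : a ∈ D.idx) (hb : b ∈ D.idx) (ha' : a' ∈ D.idx) (hb' : b' ∈ D.idx) (h1 : a ≠ a')
    (h2 : b ≠ b') {X Y : Mat D} (hX : X = α • E a b + β • E a' b')
    (hY : Y = α' • E b a + β' • E b' a') :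
    X * Y - Y * X = Matrix.diagonal fun r : D.idx => (((eE a + eE a' - eE b - eE b') r : ℤ) : KU) := by
  have c1 := mul_comm α α'
  have c2 := mul_comm β β'
  subst hX hY
  simp only [mul_add, add_mul, smul_mul_smul_comm, E_mul_zero h1, E_mul_zero h1.symm,
    E_mul_zero h2, E_mul_zero h2.symm, smul_zero, add_zero, zero_add, E_mul_E, ha, hb, ha', hb',
    and_true, if_true, ← c1, ← c2, hα, hβ, one_smul, E_self, Matrix.diagonal_add,
    Matrix.diagonal_sub]
  congr 1
  funext r
  simp only [Pi.add_apply, Pi.sub_apply]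
  push_cast
  ring

theorem comm_one {a b : ℤ} {α α' : KU} (hα : α * α' = 1)
    (ha : a ∈ D.idx) (hb : b ∈ D.idx) {X Y : Mat D} (hX : X = α • E a b) (hY : Y = α' • E b a) :
    X * Y - Y * X = Matrix.diagonal fun r : D.idx => (((eE a - eE b) r : ℤ) : KU) := by
  have c1 := mul_comm α α'
  subst hX hY
  simp only [smul_mul_smul_comm, E_mul_E, ha, hb,
    and_true, if_true, ← c1, hα, one_smul, E_self,
    Matrix.diagonal_sub]
  congr 1
  funext r
  simp only [Pi.sub_apply]
  push_cast
  ring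

theorem rhs_eq (z : KK) (m : ℤ → ℤ) :
    (z - z⁻¹)⁻¹ • (qDiag m - qDiag (-m) : Mat D) =
      Matrix.diagonal fun r : D.idx => algebraMap KK KU ((z - z⁻¹)⁻¹ * (q ^ m r - q ^ (-m r))) := by
  simp only [qDiag, Matrix.diagonal_sub, ← Matrix.diagonal_smul, Pi.neg_apply]
  congr 1
  funext r
  simp only [Pi.smul_apply, Algebra.smul_def, map_mul, map_sub]

theorem sub_inv_ne_zero {z : KK} (h0 : z ≠ 0) (h : z ^ 2 ≠ 1) : z - z⁻¹ ≠ 0 := by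
  intro e
  apply h
  rw [sub_eq_zero] at e
  rw [pow_two]; nth_rewrite 2 [e]; exact mul_inv_cancel₀ h0

theorem rhs_q (m : ℤ) (h : m = 0 ∨ m = 1 ∨ m = -1) :
    (q - q⁻¹)⁻¹ * (q ^ m - q ^ (-m)) = m := by
  have := sub_inv_ne_zero q_ne_zero (q_pow_ne_one 2 (by norm_num))
  rcases h with rfl | rfl | rfl
  · simp
  · simp [this]
  · simp only [zpow_neg_one, neg_neg, zpow_one, Int.cast_neg, Int.cast_one]
    rw [← neg_sub _ (_ : KK)⁻¹, mul_neg, inv_mul_cancel₀ this]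

theorem rhs_q2 (m : ℤ) (h : m = 0 ∨ m = 1 ∨ m = -1) :
    (q ^ 2 - (q ^ 2)⁻¹)⁻¹ * (q ^ (2 * m) - q ^ (-(2 * m))) = m := by
  have := sub_inv_ne_zero (pow_ne_zero 2 q_ne_zero)
    (by rw [← pow_mul]; exact q_pow_ne_one 4 (by norm_num))
  rw [← mul_neg, _root_.zpow_mul, _root_.zpow_mul, zpow_ofNat]
  rcases h with rfl | rfl | rfl
  · simp
  · simp [this]
  · simp only [zpow_neg_one, neg_neg, zpow_one, Int.cast_neg, Int.cast_one]
    rw [← neg_sub _ (_ : KK)⁻¹, mul_neg, inv_mul_cancel₀ this]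

theorem rhs_qh (m : ℤ) (h : m = 0 ∨ m = 1 ∨ m = -1) :
    (qHalf - qHalf⁻¹)⁻¹ * (q ^ m - q ^ (-m)) = cB ^ 2 * m := by
  have := sub_inv_ne_zero qHalf_ne_zero (qHalf_pow_ne_one 2 (by norm_num))
  have e : (qHalf - qHalf⁻¹)⁻¹ * (q - q⁻¹) = cB ^ 2 := by
    rw [cB_sq, inv_mul_eq_iff_eq_mul₀ this, ← qHalf_sq]
    have := qHalf_ne_zero
    field_simp
    ring
  rcases h with rfl | rfl | rfl
  · simp
  · simp [e]
  · simp only [zpow_neg_one, neg_neg, zpow_one, Int.cast_neg, Int.cast_one]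
    rw [← neg_sub q, mul_neg, e, mul_neg_one]

theorem D_q_two {i : D.I} (h : D.twoD i = 2) : D.q i = q := by
  rw [AffineDatum.q, h, ← qHalf_sq]; norm_cast

theorem D_q_four {i : D.I} (h : D.twoD i = 4) : D.q i = q ^ 2 := by
  rw [AffineDatum.q, h, ← qHalf_sq]; norm_cast; rw [← pow_mul]

theorem D_q_one {i : D.I} (h : D.twoD i = 1) : D.q i = qHalf := by
  rw [AffineDatum.q, h, zpow_one]

theorem xy_same_of_two {X Y : Mat D} {i : D.I} (h : D.twoD i = 2) (m : ℤ → ℤ)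
    (hXY : X * Y - Y * X = Matrix.diagonal fun r : D.idx => ((m r : ℤ) : KU))
    (hm : kExp D i = m) (h' : ∀ r, m r = 0 ∨ m r = 1 ∨ m r = -1) :
    X * Y - Y * X = (D.q i - (D.q i)⁻¹)⁻¹ • (qDiag (kExp D i) - qDiag (-kExp D i)) := by
  rw [hXY, rhs_eq, D_q_two h, hm]
  congr 1
  funext r
  rw [rhs_q _ (h' r)]
  simp

theorem xy_same_of_four {X Y : Mat D} {i : D.I} (h : D.twoD i = 4) (m : ℤ → ℤ)
    (hXY : X * Y - Y * X = Matrix.diagonal fun r : D.idx => ((m r : ℤ) : KU))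
    (hm : kExp D i = 2 * m) (h' : ∀ r, m r = 0 ∨ m r = 1 ∨ m r = -1) :
    X * Y - Y * X = (D.q i - (D.q i)⁻¹)⁻¹ • (qDiag (kExp D i) - qDiag (-kExp D i)) := by
  rw [hXY, rhs_eq, D_q_four h, hm]
  congr 1
  funext r
  simp only [Pi.mul_apply, Pi.ofNat_apply]
  rw [rhs_q2 _ (h' r)]
  simp

end

theorem xy_same (D : AffineDatum) (v : KUˣ) (i : D.I) :
    xMat D v i * yMat D v i - yMat D v i * xMat D v i =
      (D.q i - (D.q i)⁻¹)⁻¹ • (qDiag (kExp D i) - qDiag (-kExp D i)) := by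
  have hi : (i : ℕ) ≤ D.n := Nat.lt_succ_iff.mp i.2
  have hn := D.hn
  have hv : (v : KU) * ((v⁻¹ : KUˣ) : KU) = 1 := v.mul_inv
  cases hD : D.type
  · have ht : D.twoD i = 2 := by simp [AffineDatum.twoD, hD]
    have hn' : 1 ≤ D.n := by simpa [hD, ClassicalType.minRank] using hn
    by_cases i0 : (i : ℕ) = 0
    · refine xy_same_of_two ht (eE (D.n + 1) - eE 1) (comm_one (α := v) (α' := (v⁻¹ : KUˣ)) hv
        ?_ ?_ ?_ ?_) ?_ ?_
      · simp only [AffineDatum.idx, hD, Finset.mem_Icc, Finset.mem_erase]; omega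
      · simp only [AffineDatum.idx, hD, Finset.mem_Icc, Finset.mem_erase]; omega
      · simp [xMat, hD, i0]
      · simp [yMat, hD, i0]
      · simp [kExp, hD, i0]
      · intro r; simp only [Pi.sub_apply, eE]; split_ifs <;> omega
    · refine xy_same_of_two ht (eE (i : ℕ) - eE ((i : ℕ) + 1)) (comm_one (α := 1) (α' := 1) (one_mul 1)
        ?_ ?_ ?_ ?_) ?_ ?_
      · simp only [AffineDatum.idx, hD, Finset.mem_Icc, Finset.mem_erase]; omega
      · simp only [AffineDatum.idx, hD, Finset.mem_Icc, Finset.mem_erase]; omega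
      · simp [xMat, hD, i0]
      · simp [yMat, hD, i0]
      · simp [kExp, hD, i0]
      · intro r; simp only [Pi.sub_apply, eE]; split_ifs <;> omega
  · have hC : D.type ≠ .C := by simp [hD]
    have hn' : 2 ≤ D.n := by simpa [hD, ClassicalType.minRank] using hn
    by_cases i0 : (i : ℕ) = 0
    · have ht : D.twoD i = 2 := by simp only [AffineDatum.twoD, hD]; rw [if_neg (by omega)]
      refine xy_same_of_two ht _ (comm_two (a := D.n - 1) (b := -D.n) (a' := D.n) (b' := -D.n + 1)
        (α := v) (α' := (v⁻¹ : KUˣ)) (β := -v) (β' := -(v⁻¹ : KUˣ)) hv (by simp)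
        ?_ ?_ ?_ ?_ ?_ ?_ ?_ ?_) ?_ ?_
      · simp only [AffineDatum.idx, hD, Finset.mem_Icc, Finset.mem_erase]; omega
      · simp only [AffineDatum.idx, hD, Finset.mem_Icc, Finset.mem_erase]; omega
      · simp only [AffineDatum.idx, hD, Finset.mem_Icc, Finset.mem_erase]; omega
      · simp only [AffineDatum.idx, hD, Finset.mem_Icc, Finset.mem_erase]; omega
      · omega
      · omega
      · simp only [xMat, hD, i0, F_eq hC]; simp [smul_sub, sub_eq_add_neg, add_comm]
      · simp only [yMat, hD, i0, F_eq hC]; simp [smul_sub, sub_eq_add_neg, add_comm]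
      · funext r; simp only [kExp, hD, i0, eE, eF, Pi.add_apply, Pi.sub_apply, if_true]
        grind
      · intro r; simp only [Pi.add_apply, Pi.sub_apply, eE]; grind
    · by_cases i1 : (i : ℕ) < D.n
      · have ht : D.twoD i = 2 := by simp only [AffineDatum.twoD, hD]; rw [if_neg (by omega)]
        refine xy_same_of_two ht _ (comm_two (a := -(D.n + 1 - (i : ℕ))) (b := -(D.n + 1 - (i : ℕ)) + 1)
          (a' := D.n + 1 - (i : ℕ) - 1) (b' := D.n + 1 - (i : ℕ))
          (α := 1) (α' := 1) (β := -1) (β' := -1) (by simp) (by simp)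
          ?_ ?_ ?_ ?_ ?_ ?_ ?_ ?_) ?_ ?_
        · simp only [AffineDatum.idx, hD, Finset.mem_Icc, Finset.mem_erase]; omega
        · simp only [AffineDatum.idx, hD, Finset.mem_Icc, Finset.mem_erase]; omega
        · simp only [AffineDatum.idx, hD, Finset.mem_Icc, Finset.mem_erase]; omega
        · simp only [AffineDatum.idx, hD, Finset.mem_Icc, Finset.mem_erase]; omega
        · omega
        · omega
        · simp only [xMat, hD, i0, i1, F_eq hC]; simp [sub_eq_add_neg, add_comm]
        · simp only [yMat, hD, i0, i1, F_eq hC]; simp [sub_eq_add_neg, add_comm]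
        · funext r; simp only [kExp, hD, i0, i1, eE, eF, Pi.add_apply, Pi.sub_apply, if_true, if_false]
          grind
        · intro r; simp only [Pi.add_apply, Pi.sub_apply, eE]; grind
      · have ht : D.twoD i = 1 := by simp only [AffineDatum.twoD, hD]; rw [if_pos (by omega)]
        have m1 : -1 ∈ D.idx := by simp only [AffineDatum.idx, hD, Finset.mem_Icc, Finset.mem_erase]; omega
        have m2 : 0 ∈ D.idx := by simp [AffineDatum.idx, hD]
        have m3 : 1 ∈ D.idx := by simp only [AffineDatum.idx, hD, Finset.mem_Icc, Finset.mem_erase]; omega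
        have hk : kExp D i = -eF 1 := by simp [kExp, hD, i0, i1]
        have h0 := qHalf_ne_zero
        have h0' : algebraMap KK KU qHalf ≠ 0 := by simpa using h0
        have h1 : ∀ r, (-eF 1) r = 0 ∨ (-eF 1) r = 1 ∨ (-eF 1) r = -1 := by
          intro r; simp only [Pi.neg_apply, eF]; grind
        rw [rhs_eq, D_q_one ht, hk]
        simp only [rhs_qh _ (h1 _)]
        simp only [xMat, yMat, hD, i0, i1, if_false, smul_mul_smul_comm, mul_sub, sub_mul,
          smul_mul_assoc, mul_smul_comm, E_mul_E, m1, m2, m3, and_true, if_true,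
          show ((0 : ℤ) = 1) = False by simp, show ((1 : ℤ) = -1) = False by simp,
          show ((1 : ℤ) = 0) = False by simp, show ((0 : ℤ) = -1) = False by simp,
          show ((-1 : ℤ) = 0) = False by simp, show ((-1 : ℤ) = 1) = False by simp,
          false_and, smul_zero, sub_zero, zero_sub, smul_smul, map_inv₀, inv_mul_cancel₀ h0',
          mul_inv_cancel₀ h0', one_smul, E_self]
        ext r s
        simp only [Matrix.sub_apply, Matrix.smul_apply, Matrix.neg_apply, Matrix.diagonal_apply,
          smul_eq_mul, eE, eF, Pi.neg_apply, map_mul, map_pow, map_intCast]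
        generalize algebraMap KK KU qHalf = g at *
        generalize algebraMap KK KU cB = c at *
        split_ifs <;> (try omega) <;> (push_cast; field_simp; try ring)
  · have hn' : 1 ≤ D.n := by simpa [hD, ClassicalType.minRank] using hn
    by_cases i0 : (i : ℕ) = 0
    · have ht : D.twoD i = 4 := by simp only [AffineDatum.twoD, hD]; rw [if_pos (by omega)]
      refine xy_same_of_four ht (eE D.n - eE (-D.n)) (comm_one (α := v) (α' := (v⁻¹ : KUˣ)) hv
        ?_ ?_ ?_ ?_) ?_ ?_
      · simp only [AffineDatum.idx, hD, Finset.mem_Icc, Finset.mem_erase]; omega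
      · simp only [AffineDatum.idx, hD, Finset.mem_Icc, Finset.mem_erase]; omega
      · simp only [xMat, hD, i0, if_true]; rw [F_C hD _ _ (by omega) (by omega)]
        simp [smul_smul, mul_right_comm _ _ (2 : KU)]
      · simp only [yMat, hD, i0, if_true]; rw [F_C hD _ _ (by omega) (by omega)]
        simp [smul_smul, mul_right_comm _ _ (2 : KU)]
      · funext r; simp [kExp, hD, i0, eE, eF]
      · intro r; simp only [Pi.sub_apply, eE]; grind
    · by_cases i1 : (i : ℕ) < D.n
      · have ht : D.twoD i = 2 := by simp only [AffineDatum.twoD, hD]; rw [if_neg (by omega)]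
        refine xy_same_of_two ht _ (comm_two (a := -(D.n + 1 - (i : ℕ))) (b := -(D.n + 1 - (i : ℕ)) + 1)
          (a' := D.n + 1 - (i : ℕ) - 1) (b' := D.n + 1 - (i : ℕ))
          (α := 1) (α' := 1) (β := -1) (β' := -1) (by simp) (by simp)
          ?_ ?_ ?_ ?_ ?_ ?_ ?_ ?_) ?_ ?_
        · simp only [AffineDatum.idx, hD, Finset.mem_Icc, Finset.mem_erase]; omega
        · simp only [AffineDatum.idx, hD, Finset.mem_Icc, Finset.mem_erase]; omega
        · simp only [AffineDatum.idx, hD, Finset.mem_Icc, Finset.mem_erase]; omega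
        · simp only [AffineDatum.idx, hD, Finset.mem_Icc, Finset.mem_erase]; omega
        · omega
        · omega
        · simp only [xMat, hD, i0, i1, if_true, if_false]
          rw [F_eq_same _ _ (by nlinarith)]; simp [sub_eq_add_neg, add_comm]
        · simp only [yMat, hD, i0, i1, if_true, if_false]
          rw [F_eq_same _ _ (by nlinarith)]; simp [sub_eq_add_neg, add_comm]
        · funext r; simp only [kExp, hD, i0, i1, eE, eF, Pi.add_apply, Pi.sub_apply, if_true, if_false]
          grind
        · intro r; simp only [Pi.add_apply, Pi.sub_apply, eE]; grind
      · have ht : D.twoD i = 4 := by simp only [AffineDatum.twoD, hD]; rw [if_pos (by omega)]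
        refine xy_same_of_four ht (eE (-1) - eE 1) (comm_one (α := 1) (α' := 1) (by simp)
          ?_ ?_ ?_ ?_) ?_ ?_
        · simp only [AffineDatum.idx, hD, Finset.mem_Icc, Finset.mem_erase]; omega
        · simp only [AffineDatum.idx, hD, Finset.mem_Icc, Finset.mem_erase]; omega
        · simp only [xMat, hD, i0, i1, if_false]; rw [F_C hD _ _ (by omega) (by omega)]
          simp [smul_smul]
        · simp only [yMat, hD, i0, i1, if_false]; rw [F_C hD _ _ (by omega) (by omega)]
          simp [smul_smul]
        · funext r; simp [kExp, hD, i0, i1, eE, eF]; try ring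
        · intro r; simp only [Pi.sub_apply, eE]; grind
  · have hC : D.type ≠ .C := by simp [hD]
    have ht : D.twoD i = 2 := by simp [AffineDatum.twoD, hD]
    have hn' : 3 ≤ D.n := by simpa [hD, ClassicalType.minRank] using hn
    by_cases i0 : (i : ℕ) = 0
    · refine xy_same_of_two ht _ (comm_two (a := D.n - 1) (b := -D.n) (a' := D.n) (b' := -D.n + 1)
        (α := v) (α' := (v⁻¹ : KUˣ)) (β := -v) (β' := -(v⁻¹ : KUˣ)) hv (by simp)
        ?_ ?_ ?_ ?_ ?_ ?_ ?_ ?_) ?_ ?_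
      · simp only [AffineDatum.idx, hD, Finset.mem_Icc, Finset.mem_erase]; omega
      · simp only [AffineDatum.idx, hD, Finset.mem_Icc, Finset.mem_erase]; omega
      · simp only [AffineDatum.idx, hD, Finset.mem_Icc, Finset.mem_erase]; omega
      · simp only [AffineDatum.idx, hD, Finset.mem_Icc, Finset.mem_erase]; omega
      · omega
      · omega
      · simp only [xMat, hD, i0, F_eq hC]; simp [smul_sub, sub_eq_add_neg, add_comm]
      · simp only [yMat, hD, i0, F_eq hC]; simp [smul_sub, sub_eq_add_neg, add_comm]
      · funext r; simp only [kExp, hD, i0, eE, eF, Pi.add_apply, Pi.sub_apply, if_true]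
        grind
      · intro r; simp only [Pi.add_apply, Pi.sub_apply, eE]; grind
    · by_cases i1 : (i : ℕ) < D.n
      · refine xy_same_of_two ht _ (comm_two (a := -(D.n + 1 - (i : ℕ))) (b := -(D.n + 1 - (i : ℕ)) + 1)
          (a' := D.n + 1 - (i : ℕ) - 1) (b' := D.n + 1 - (i : ℕ))
          (α := 1) (α' := 1) (β := -1) (β' := -1) (by simp) (by simp)
          ?_ ?_ ?_ ?_ ?_ ?_ ?_ ?_) ?_ ?_
        · simp only [AffineDatum.idx, hD, Finset.mem_Icc, Finset.mem_erase]; omega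
        · simp only [AffineDatum.idx, hD, Finset.mem_Icc, Finset.mem_erase]; omega
        · simp only [AffineDatum.idx, hD, Finset.mem_Icc, Finset.mem_erase]; omega
        · simp only [AffineDatum.idx, hD, Finset.mem_Icc, Finset.mem_erase]; omega
        · omega
        · omega
        · simp only [xMat, hD, i0, i1, F_eq hC]; simp [sub_eq_add_neg, add_comm]
        · simp only [yMat, hD, i0, i1, F_eq hC]; simp [sub_eq_add_neg, add_comm]
        · funext r; simp only [kExp, hD, i0, i1, eE, eF, Pi.add_apply, Pi.sub_apply, if_true, if_false]
          grind
        · intro r; simp only [Pi.add_apply, Pi.sub_apply, eE]; grind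
      · refine xy_same_of_two ht _ (comm_two (a := -2) (b := 1)
          (a' := -1) (b' := 2)
          (α := 1) (α' := 1) (β := -1) (β' := -1) (by simp) (by simp)
          ?_ ?_ ?_ ?_ ?_ ?_ ?_ ?_) ?_ ?_
        · simp only [AffineDatum.idx, hD, Finset.mem_Icc, Finset.mem_erase]; omega
        · simp only [AffineDatum.idx, hD, Finset.mem_Icc, Finset.mem_erase]; omega
        · simp only [AffineDatum.idx, hD, Finset.mem_Icc, Finset.mem_erase]; omega
        · simp only [AffineDatum.idx, hD, Finset.mem_Icc, Finset.mem_erase]; omega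
        · omega
        · omega
        · simp only [xMat, hD, i0, i1, F_eq hC]; simp [sub_eq_add_neg, add_comm]
        · simp only [yMat, hD, i0, i1, F_eq hC]; simp [sub_eq_add_neg, add_comm]
        · funext r; simp only [kExp, hD, i0, i1, eE, eF, Pi.add_apply, Pi.sub_apply, if_true, if_false,
            Pi.neg_apply]
          grind
        · intro r; simp only [Pi.add_apply, Pi.sub_apply, eE]; grind

theorem ent_xy (D : AffineDatum) (i j : D.I) (hij : i ≠ j)
    (hs : ¬ Special D i j) (hs' : ¬ Special D j i) :
    NoProd (ent D (i : ℕ)) (ent D (j : ℕ)).swap ∧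
      NoProd (ent D (j : ℕ)).swap (ent D (i : ℕ)) := by
  have hi : (i : ℕ) ≤ D.n := Nat.lt_succ_iff.mp i.2
  have hj : (j : ℕ) ≤ D.n := Nat.lt_succ_iff.mp j.2
  have hn := D.hn
  have hij' : (i : ℕ) ≠ j := fun e => hij (Fin.ext e)
  simp only [NoProd, Special, Ent.swap] at *
  clear hij
  cases hD : D.type <;>
    simp only [ent, hD, ClassicalType.minRank,
      reduceCtorEq, true_or, or_true, true_and, false_and, or_false, false_or] at hn hs hs' ⊢
  · split_ifs <;> simp only <;> omega
  · refine ⟨⟨?_, ?_, ?_, ?_⟩, ?_, ?_, ?_, ?_⟩ <;> split_ifs <;> simp only <;> omega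
  · split_ifs <;> simp only <;> omega
  · refine ⟨⟨?_, ?_, ?_, ?_⟩, ?_, ?_, ?_, ?_⟩ <;> split_ifs <;> simp only <;> omega

theorem special_mat (D : AffineDatum) (v : KUˣ) (i j : D.I) (h : Special D i j) :
    xMat D v i * xMat D v j = xMat D v j * xMat D v i ∧
    xMat D v i * yMat D v j = yMat D v j * xMat D v i ∧
    xMat D v j * yMat D v i = yMat D v i * xMat D v j ∧
    yMat D v i * yMat D v j = yMat D v j * yMat D v i := by
  have hn := D.hn
  rcases h with ⟨hD, hi, hj⟩ | ⟨hD, hi, hj⟩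
  · have hC : D.type ≠ .C := by rcases hD with h | h <;> simp [h]
    have hn' : 2 ≤ D.n := by rcases hD with h | h <;> simp [h, ClassicalType.minRank] at hn <;> omega
    have h1 : 1 < D.n := by omega
    apply special_aux (D := D) (D.n - 1) D.n (α := v) (β := 1) (α' := ((v⁻¹ : KUˣ) : KU)) (β' := 1)
    · omega
    · omega
    · omega
    · omega
    iterate 4
      rcases hD with hD | hD <;>
        simp only [AffineDatum.idx, hD, Finset.mem_Icc, Finset.mem_erase] <;> omega
    iterate 4
      rcases hD with hD | hD <;> simp [xMat, yMat, hD, hi, hj, h1, F_eq hC, add_comm, sub_eq_add_neg]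
  · have hC : D.type ≠ .C := by simp [hD]
    have hn' : 3 ≤ D.n := by simpa [hD, ClassicalType.minRank] using hn
    have i0 : ¬ (i : ℕ) = 0 := by omega
    have i1 : (i : ℕ) < D.n := by omega
    have j0 : ¬ (j : ℕ) = 0 := by omega
    have j1 : ¬ (j : ℕ) < D.n := by omega
    have e : (D.n : ℤ) + 1 - (i : ℕ) = 2 := by omega
    have := special_aux (D := D) (-2) (-1) (α := 1) (β := -1) (α' := 1) (β' := -1)
      (X := xMat D v j) (X' := xMat D v i) (Y := yMat D v j) (Y' := yMat D v i)
      (by omega) (by omega) (by omega) (by omega)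
      (by simp only [AffineDatum.idx, hD, Finset.mem_Icc, Finset.mem_erase]; omega)
      (by simp only [AffineDatum.idx, hD, Finset.mem_Icc, Finset.mem_erase]; omega)
      (by simp only [AffineDatum.idx, hD, Finset.mem_Icc, Finset.mem_erase]; omega)
      (by simp only [AffineDatum.idx, hD, Finset.mem_Icc, Finset.mem_erase]; omega)
      (by simp [xMat, hD, j0, j1, F_eq hC])
      (by simp only [xMat, hD, i0, i1, F_eq hC, e]; simp)
      (by simp [yMat, hD, j0, j1, F_eq hC])
      (by simp only [yMat, hD, i0, i1, F_eq hC, e]; simp)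
    exact ⟨this.1.symm, this.2.2.1, this.2.1, this.2.2.2.symm⟩

theorem xy_mat (D : AffineDatum) (v : KUˣ) (i : D.I) : ∃ α β α' β' : KU,
    xMat D v i = (ent D (i : ℕ)).mat D α β ∧ yMat D v i = (ent D (i : ℕ)).swap.mat D α' β' :=
  xy_ent D v i

theorem xy_ne (D : AffineDatum) (v : KUˣ) (i j : D.I) (hij : i ≠ j) :
    xMat D v i * yMat D v j = yMat D v j * xMat D v i := by
  by_cases h1 : Special D i j
  · exact (special_mat D v i j h1).2.1
  by_cases h2 : Special D j i
  · exact (special_mat D v j i h2).2.2.1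
  obtain ⟨h3, h4⟩ := ent_xy D i j hij h1 h2
  obtain ⟨α, β, _, _, hx, _⟩ := xy_mat D v i
  obtain ⟨_, _, γ, δ, _, hy⟩ := xy_mat D v j
  rw [hx, hy, h3.mul_eq, h4.mul_eq]

theorem a_symm_zero (D : AffineDatum) (i j : D.I) (h : D.a i j = 0) :
    D.a j i = 0 := by
  have h1 := D.symm i j
  rw [h, mul_zero] at h1
  have : D.twoD j ≠ 0 := by
    unfold AffineDatum.twoD; cases D.type <;> simp only <;> (try split_ifs) <;> omega
  simpa [this] using h1.symm

theorem xx_comm (D : AffineDatum) (v : KUˣ) (i j : D.I) (hij : i ≠ j) (h : D.a i j = 0) :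
    xMat D v i * xMat D v j = xMat D v j * xMat D v i ∧
    yMat D v i * yMat D v j = yMat D v j * yMat D v i := by
  by_cases h1 : Special D i j
  · exact ⟨(special_mat D v i j h1).1, (special_mat D v i j h1).2.2.2⟩
  by_cases h2 : Special D j i
  · exact ⟨(special_mat D v j i h2).1.symm, (special_mat D v j i h2).2.2.2.symm⟩
  have h3 := ent_comm D i j hij h h1 h2
  have h4 := ent_comm D j i hij.symm (a_symm_zero D i j h) h2 h1
  obtain ⟨α, β, _, _, hx, hy⟩ := xy_mat D v i
  obtain ⟨_, _, γ, δ, hx', hy'⟩ := xy_mat D v j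
  rw [hx, hy, hx', hy', h3.mul_eq, h4.mul_eq, h3.swap.mul_eq, h4.swap.mul_eq]
  exact ⟨rfl, rfl⟩

theorem a_cases (D : AffineDatum) (i j : D.I) (hij : i ≠ j) :
    D.a i j = 0 ∨ D.a i j = -1 ∨ D.a i j = -2 := by
  have hij' : (i : ℕ) ≠ j := fun e => hij (Fin.ext e)
  unfold AffineDatum.a cartanA cartanB cartanC cartanD
  cases D.type <;> simp only <;> split_ifs <;> omega

theorem serre_mat (D : AffineDatum) (v : KUˣ) (i j : D.I) (hij : i ≠ j) :
    serre (D.q i) (1 - D.a i j).toNat (xMat D v i) (xMat D v j) = 0 ∧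
    serre (D.q i) (1 - D.a i j).toNat (yMat D v i) (yMat D v j) = 0 := by
  have hi : (i : ℕ) ≤ D.n := Nat.lt_succ_iff.mp i.2
  have hj : (j : ℕ) ≤ D.n := Nat.lt_succ_iff.mp j.2
  have hij' : (i : ℕ) ≠ j := fun e => hij (Fin.ext e)
  rcases a_cases D i j hij with h | h | h
  · have := xx_comm D v i j hij h
    rw [h]
    exact ⟨serre_one _ _ _ this.1, serre_one _ _ _ this.2⟩
  · obtain ⟨α, β, _, _, hx, hy⟩ := xy_mat D v i
    obtain ⟨_, _, γ, δ, hx', hy'⟩ := xy_mat D v j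
    have h1 := ent_sq D i (by
      intro hD
      rcases hi.lt_or_eq with h' | h'
      · exact h'
      · exfalso
        simp only [AffineDatum.a, hD, cartanB, h'] at h
        split_ifs at h <;> omega)
    have h2 := ent_triple D i j h
    rw [h, hx, hy, hx', hy']
    exact ⟨serre_two _ _ _ (h1.mul_eq _ _ _ _) (h2.mul_eq _ _ _ _),
      serre_two _ _ _ (h1.swap.mul_eq _ _ _ _) (h2.swap.mul_eq _ _ _ _)⟩
  · rw [h]
    by_cases hB : D.type = .B → (i : ℕ) < D.n
    · obtain ⟨α, β, _, _, hx, hy⟩ := xy_mat D v i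
      have h1 := ent_sq D i hB
      have e1 := h1.mul_eq (D := D) α β α β
      have e2 (α β) := h1.swap.mul_eq (D := D) α β α β
      rw [hx, hy]
      exact ⟨serre_three _ _ _ (by rw [e1, zero_mul]) (by rw [e1, zero_mul, zero_mul])
          (by rw [mul_assoc, e1, mul_zero]),
        serre_three _ _ _ (by rw [e2, zero_mul]) (by rw [e2, zero_mul, zero_mul])
          (by rw [mul_assoc, e2, mul_zero])⟩
    · push Not at hB
      obtain ⟨hD, hB⟩ := hB
      have hi' : (i : ℕ) = D.n := by omega
      have hn : 2 ≤ D.n := by simpa [hD, ClassicalType.minRank] using D.hn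
      have i0 : ¬ (i : ℕ) = 0 := by omega
      obtain ⟨α, β, α', β', hx, hy⟩ := xy_mat D v i
      obtain ⟨γ, δ, γ', δ', hx', hy'⟩ := xy_mat D v j
      have he : ent D (i : ℕ) = ⟨-1, 0, 0, 1⟩ := by
        simp only [ent, hD]; rw [if_neg (by omega), if_neg (by omega)]
      have hf : ent D (j : ℕ) = ⟨-2, -1, 1, 2⟩ ∨ ent D (j : ℕ) = ⟨1, -2, 2, -1⟩ := by
        simp only [AffineDatum.a, hD, cartanB] at h
        simp only [ent, hD]
        split_ifs at h with h1 h2 h3 <;> try omega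
        by_cases j0 : (j : ℕ) = 0
        · right
          have : D.n = 2 := by omega
          simp [j0, this]
        · left
          have : (D.n : ℤ) + 1 - (j : ℕ) = 2 := by omega
          rw [if_neg (by omega), if_pos (by omega), this]
          rfl
      rw [hx, hx', hy, hy', he]
      have z1 : (-1 : ℤ) ≠ 1 := by decide
      rcases hf with hf | hf <;> rw [hf] <;> constructor <;> apply serre_three <;>
        simp [Ent.mat, Ent.swap, mul_add, add_mul, E_mul_E, ite_and]

theorem qDiag_mul_ent (D : AffineDatum) (m : ℤ → ℤ) (e : Ent) (α β : KU) (c : KK)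
    (h1 : q ^ m e.a = c * q ^ m e.b) (h2 : q ^ m e.a' = c * q ^ m e.b') :
    qDiag m * e.mat D α β = c • (e.mat D α β * qDiag m) := by
  rw [Ent.mat, mul_add, add_mul, smul_add, ← algebraMap_smul KU c, ← algebraMap_smul KU c]
  simp only [mul_smul_comm, smul_mul_assoc, qDiag_mul_E, E_mul_qDiag, h1, h2, map_mul, smul_smul]
  congr 2 <;> ring

theorem q_pow_kExp (D : AffineDatum) (i : D.I) (a b m : ℤ)
    (h : 2 * (kExp D i a - kExp D i b) = D.twoD i * m) :
    q ^ kExp D i a = D.q i ^ m * q ^ kExp D i b ∧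
      q ^ kExp D i b = D.q i ^ (-m) * q ^ kExp D i a := by
  have h' : 2 * (kExp D i b - kExp D i a) = D.twoD i * -m := by linarith
  constructor
  · rw [AffineDatum.q, ← _root_.zpow_mul, ← h, _root_.zpow_mul, zpow_ofNat, qHalf_sq,
      ← zpow_add₀ q_ne_zero, sub_add_cancel]
  · rw [AffineDatum.q, ← _root_.zpow_mul, ← h', _root_.zpow_mul, zpow_ofNat, qHalf_sq,
      ← zpow_add₀ q_ne_zero, sub_add_cancel]

/-- The vector representation `T_v : U_q(g) → End(𝕂^N)`, extended to values `v` of the spectral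
parameter in `𝕂(u)ˣ`. -/
noncomputable def vecRep (D : AffineDatum) (v : KUˣ) : Uq D →ₐ[KK] Mat D :=
  Uq.lift (genLift (xMat D v) (yMat D v) (fun i => qDiag (kExp D i)) (fun i => qDiag (-kExp D i)))
    <| by
    apply genLift_rel
    · intro i; rw [qDiag_mul, add_neg_cancel, qDiag_zero]
    · intro i; rw [qDiag_mul, neg_add_cancel, qDiag_zero]
    · intro i j; rw [qDiag_mul, qDiag_mul, add_comm]
    · intro i j
      obtain ⟨α, β, _, _, hx, _⟩ := xy_mat D v j
      obtain ⟨h1, h2⟩ := kExp_wt D i j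
      rw [hx]
      exact qDiag_mul_ent D _ _ _ _ _ (q_pow_kExp D i _ _ _ h1).1 (q_pow_kExp D i _ _ _ h2).1
    · intro i j
      obtain ⟨_, _, α, β, _, hy⟩ := xy_mat D v j
      obtain ⟨h1, h2⟩ := kExp_wt D i j
      rw [hy]
      exact qDiag_mul_ent D _ _ _ _ _ (q_pow_kExp D i _ _ _ h1).2 (q_pow_kExp D i _ _ _ h2).2
    · exact xy_same D v
    · exact xy_ne D v
    · exact fun i j h => (serre_mat D v i j h).1
    · exact fun i j h => (serre_mat D v i j h).2

/-! ### Boundary intertwining equations -/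

/-- The spectral parameter `u`, an invertible element of `𝕂(u)`. -/
noncomputable def uVar : KUˣ := Units.mk0 RatFunc.X RatFunc.X_ne_zero

/-- A scalar in `𝕂ˣ`, viewed in `𝕂(u)ˣ`. -/
noncomputable def scalar (η : KKˣ) : KUˣ := Units.map (algebraMap KK KU).toMonoidHom η

/-- `(K(u), η)` solves the untwisted boundary intertwining equation for all `b ∈ B`:
`K(u) T_{ηu}(b) = T_{η/u}(b) K(u)`, an equation of matrix-valued rational functions of `u`. -/
def IsUntwistedSolution {D : AffineDatum} (B : Subalgebra KK (Uq D)) (K : Mat D) (η : KKˣ) : Prop :=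
  ∀ b ∈ B, K * vecRep D (scalar η * uVar) b = vecRep D (scalar η * uVar⁻¹) b * K

/-- `(K(u), η)` solves the twisted boundary intertwining equation for all `b ∈ B`:
`K(u) T_{ηu}(b) = (T_{η/u}(S(b)))ᵗ K(u)`, an equation of matrix-valued rational functions of `u`. -/
def IsTwistedSolution {D : AffineDatum} (B : Subalgebra KK (Uq D)) (K : Mat D) (η : KKˣ) : Prop :=
  ∀ b ∈ B, K * vecRep D (scalar η * uVar) b =
    (vecRep D (scalar η * uVar⁻¹) (antipode D b)).transpose * K

/-! ### The Weyl group and generalized Satake diagrams -/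

/-- The root lattice `Q = ⊕ ℤ α_i`; an element is its tuple of coefficients. -/
abbrev RootLattice (D : AffineDatum) : Type := D.I → ℤ

/-- The simple root `α_i`. -/
def simpleRoot {D : AffineDatum} (i : D.I) : RootLattice D := Pi.single i 1

/-- The simple reflection `r_i`, with `r_i(α_j) = α_j - a_ij α_i`. -/
def reflection (D : AffineDatum) (i : D.I) (μ : RootLattice D) : RootLattice D :=
  μ - (∑ j, D.a i j * μ j) • simpleRoot i

/-- The Weyl group element `r_{i_1} ⋯ r_{i_l}` attached to a word `[i_1, …, i_l]`, through its
(faithful) action on the root lattice. -/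
def wordAction (D : AffineDatum) (w : List D.I) (μ : RootLattice D) : RootLattice D :=
  w.foldr (reflection D) μ

/-- No word of smaller length represents the same Weyl group element. -/
def IsReduced (D : AffineDatum) (w : List D.I) : Prop :=
  ∀ w' : List D.I, wordAction D w' = wordAction D w → w.length ≤ w'.length

/-- `w` is a reduced word of the longest element `w_X` of the parabolic subgroup `W_X`. -/
def IsLongestWord (D : AffineDatum) (X : Finset D.I) (w : List D.I) : Prop :=
  (∀ i ∈ w, i ∈ X) ∧ IsReduced D w ∧
    ∀ w' : List D.I, (∀ i ∈ w', i ∈ X) → IsReduced D w' → w'.length ≤ w.length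

/-- The action `α_i ↦ α_{τ(i)}` of a permutation of `I` on the root lattice. -/
def permAction {D : AffineDatum} (τ : Equiv.Perm D.I) (μ : RootLattice D) : RootLattice D :=
  fun i => μ (τ⁻¹ i)

/-- The involution `θ = -w_X τ` of the root lattice. -/
def rootTheta (D : AffineDatum) (τ : Equiv.Perm D.I) (w : List D.I) (μ : RootLattice D) :
    RootLattice D :=
  -wordAction D w (permAction τ μ)

/-- The submatrix `A_X` is of finite type: all its principal minors are positive. -/
def IsFiniteType (D : AffineDatum) (X : Finset D.I) : Prop :=
  ∀ Y ⊆ X, 0 < (Matrix.of fun i j : Y => D.a i j).det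

/-- `(X, τ)` is a generalized Satake diagram; `w` is a reduced word of `w_X`. -/
structure IsGSat (D : AffineDatum) (X : Finset D.I) (τ : Equiv.Perm D.I) (w : List D.I) :
    Prop where
  finiteType : IsFiniteType D X
  automorphism : ∀ i j, D.a (τ i) (τ j) = D.a i j
  involutive : ∀ i, τ (τ i) = i
  /-- `-w_X` and `τ` agree on the simple roots in `X` -/
  longest : ∀ i ∈ X, -wordAction D w (simpleRoot i) = simpleRoot (τ i)
  noObstruction : ∀ i ∈ X, ∀ j ∉ X,
    rootTheta D τ w (simpleRoot j) = -(simpleRoot i + simpleRoot j) → D.a j i ≠ -1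

/-- `I*` contains exactly one element of each `τ`-orbit in `I \ X`. -/
def IsTransversal {D : AffineDatum} (X : Finset D.I) (τ : Equiv.Perm D.I) (Istar : Finset D.I) :
    Prop :=
  (∀ j ∈ Istar, j ∉ X) ∧ ∀ j ∉ X, ∃! k, k ∈ Istar ∧ (k = j ∨ k = τ j)

/-- Twice the symmetric bilinear form on the root lattice with `(α_i, α_j) = d_i a_ij`. -/
def twoForm (D : AffineDatum) (μ ν : RootLattice D) : ℤ :=
  ∑ i, ∑ j, μ i * ν j * (D.twoD i * D.a i j)

/-- `I_diff = {j ∈ I* : j ≠ τ(j) and (α_j, θ(α_j)) ≠ 0}`. -/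
def Idiff (D : AffineDatum) (τ : Equiv.Perm D.I) (w : List D.I) (Istar : Finset D.I) : Set D.I :=
  {j | j ∈ Istar ∧ j ≠ τ j ∧ twoForm D (simpleRoot j) (rootTheta D τ w (simpleRoot j)) ≠ 0}

/-- `I_ns = {j ∈ I* : j = τ(j) and a_ij = 0 for all i ∈ X}`. -/
def Ins (D : AffineDatum) (X : Finset D.I) (τ : Equiv.Perm D.I) (Istar : Finset D.I) : Set D.I :=
  {j | j ∈ Istar ∧ j = τ j ∧ ∀ i ∈ X, D.a i j = 0}

/-- `I_nsf = {j ∈ I_ns : a_ij is even for all i ∈ I_ns}`. -/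
def Insf (D : AffineDatum) (X : Finset D.I) (τ : Equiv.Perm D.I) (Istar : Finset D.I) : Set D.I :=
  {j | j ∈ Ins D X τ Istar ∧ ∀ i ∈ Ins D X τ Istar, Even (D.a i j)}

/-- The parameter set `𝒞`; the values of `c` on `X` play no role. -/
def paramC (D : AffineDatum) (τ : Equiv.Perm D.I) (w : List D.I) (Istar : Finset D.I) :
    Set (D.I → KKˣ) :=
  {c | ∀ j ∈ Istar, c j ≠ c (τ j) → j ∈ Idiff D τ w Istar}

/-- The parameter set `𝒮`; the values of `s` on `X` play no role. -/
def paramS (D : AffineDatum) (X : Finset D.I) (τ : Equiv.Perm D.I) (Istar : Finset D.I) :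
    Set (D.I → KK) :=
  {s | ∀ j ∈ Istar, s j ≠ 0 → j ∈ Insf D X τ Istar}

/-! ### The automorphism `θ_q` and quantum pair algebras

The automorphisms `T_i`, `τ`, `ω_q` of `U_q(g)` are given by formulas on the generators. Here the
same formulas define endomorphisms of the free algebra on the generators; these lift the
automorphisms along the quotient map `Uq.mk` to `U_q(g)`. -/

section lifts
variable {D : AffineDatum}

/-- The divided power `x_i^{(r)}` -/
noncomputable def xDiv (i : D.I) (r : ℕ) : FreeU D := (qFact (D.q i) r)⁻¹ • x i ^ r

/-- The divided power `y_i^{(r)}` -/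
noncomputable def yDiv (i : D.I) (r : ℕ) : FreeU D := (qFact (D.q i) r)⁻¹ • y i ^ r

/-- `k_i ^ m` for an integer `m` -/
noncomputable def kPow (i : D.I) (m : ℤ) : FreeU D :=
  if 0 ≤ m then k i ^ m.toNat else kinv i ^ (-m).toNat

/-- Lusztig's automorphism `T_i = T''_{i,1}`. -/
noncomputable def braidT (i : D.I) : FreeU D →ₐ[KK] FreeU D :=
  genLift
    (fun j => if j = i then -(y i * k i) else
      ∑ r ∈ Finset.range ((-D.a i j).toNat + 1),
        ((-D.q i)⁻¹ ^ r) • (xDiv i ((-D.a i j).toNat - r) * x j * xDiv i r))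
    (fun j => if j = i then -(kinv i * x i) else
      ∑ r ∈ Finset.range ((-D.a i j).toNat + 1),
        ((-D.q i) ^ r) • (yDiv i r * y j * yDiv i ((-D.a i j).toNat - r)))
    (fun j => k j * kPow i (-D.a i j))
    (fun j => kinv j * kPow i (D.a i j))

/-- `T_{i_1} ∘ ⋯ ∘ T_{i_l}` for a word `[i_1, …, i_l]`. -/
noncomputable def braidWord (w : List D.I) : FreeU D →ₐ[KK] FreeU D :=
  w.foldr (fun i f => (braidT i).comp f) (AlgHom.id KK (FreeU D))

/-- The diagram automorphism `τ`. -/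
noncomputable def diagramAut (τ : Equiv.Perm D.I) : FreeU D →ₐ[KK] FreeU D :=
  genLift (fun i => x (τ i)) (fun i => y (τ i)) (fun i => k (τ i)) (fun i => kinv (τ i))

/-- `ω_q`: `x_i ↦ -k_i⁻¹ y_i`, `y_i ↦ -x_i k_i`, `k_i ↦ k_i⁻¹`. -/
noncomputable def omegaQ : FreeU D →ₐ[KK] FreeU D :=
  genLift (fun i => -(kinv i * y i)) (fun i => -(x i * k i)) (fun i => kinv i) (fun i => k i)

/-- `θ_q = T_{w_X} τ ω_q`. -/
noncomputable def thetaQ (τ : Equiv.Perm D.I) (w : List D.I) : FreeU D →ₐ[KK] FreeU D :=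
  (braidWord w).comp ((diagramAut τ).comp omegaQ)

/-- The fixed point set `U_q(h)^{θ_q} = {a ∈ U_q(h) : θ_q(a) = a}`, where `U_q(h)` is generated by
the `k_i` and their inverses. -/
def cartanFixed (τ : Equiv.Perm D.I) (w : List D.I) : Set (Uq D) :=
  {z | ∃ a ∈ Algebra.adjoin KK (Set.range k ∪ Set.range kinv : Set (FreeU D)),
    Uq.mk D a = z ∧ Uq.mk D (thetaQ τ w a) = z}

/-- `b_i = y_i` for `i ∈ X` and `b_i = y_i + c_i θ_q(y_i k_i) k_i⁻¹ - s_i k_i⁻¹` otherwise. -/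
noncomputable def bGen (X : Finset D.I) (τ : Equiv.Perm D.I) (w : List D.I) (c : D.I → KKˣ)
    (s : D.I → KK) (i : D.I) : Uq D :=
  if i ∈ X then Uq.mk D (y i)
  else Uq.mk D (y i + (c i : KK) • (thetaQ τ w (y i * k i) * kinv i) - s i • kinv i)

/-- The algebra `B_{c,s}(X, τ)`. -/
noncomputable def quantumPair (X : Finset D.I) (τ : Equiv.Perm D.I) (w : List D.I)
    (c : D.I → KKˣ) (s : D.I → KK) : Subalgebra KK (Uq D) :=
  Algebra.adjoin KK ({z | ∃ i ∈ X, z = Uq.mk D (x i)} ∪ cartanFixed τ w ∪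
    Set.range (bGen X τ w c s))

end lifts

/-! ### Dressing -/

/-- The conditions on the dressing parameters `ω_1, ω_2, …` (`N = n + 1` in type A). In type A the
parameters are `ω_1, …, ω_N`, in the other types `ω_1, …, ω_n`; no other value of the sequence
is used. -/
def IsDressing (D : AffineDatum) (ω : ℕ → KKˣ) : Prop :=
  D.type = .A → ∏ i ∈ Finset.Icc 1 (D.n + 1), ω i = 1

/-- The diagonal entries of `G(ω)`. -/
noncomputable def dressingEntry (D : AffineDatum) (ω : ℕ → KKˣ) (a : ℤ) : KKˣ :=
  match D.type with
  | .A => ω a.toNat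
  | _ => if a = 0 then 1
      else if a < 0 then ω (D.n + 1 + a).toNat
      else (ω (D.n + 1 - a).toNat)⁻¹

/-- The dressing matrix `G(ω)`, viewed as a constant matrix over `𝕂(u)`. -/
noncomputable def dressingMatrix (D : AffineDatum) (ω : ℕ → KKˣ) : Mat D :=
  Matrix.diagonal fun a => algebraMap KK KU (dressingEntry D ω a)

/-- The character `ζ(ω, η) : Q → 𝕂ˣ`, through its values on the simple roots. -/
noncomputable def zetaChar (D : AffineDatum) (ω : ℕ → KKˣ) (η : KKˣ) (i : D.I) : KKˣ :=
  if (i : ℕ) = 0 then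
    match D.type with
    | .A => η * (ω 1)⁻¹ * ω (D.n + 1)
    | .B => η * (ω 1)⁻¹ * (ω 2)⁻¹
    | .C => η * (ω 1)⁻¹ ^ 2
    | .D => η * (ω 1)⁻¹ * (ω 2)⁻¹
  else if (i : ℕ) < D.n then ω i * (ω (i + 1))⁻¹
  else
    match D.type with
    | .A => ω D.n * (ω (D.n + 1))⁻¹
    | .B => ω D.n
    | .C => ω D.n ^ 2
    | .D => ω (D.n - 1) * ω D.n

end QAff

open QAff

namespace QAff
open FreeU

section dressing
variable {D : AffineDatum}

/-! Write $G=G(\omega)$ and $\zeta=\zeta(\omega,\eta)$. Everything follows from one identity, valid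
for all $b\in U_q(\mathfrak g)$ and every value $v$ of the spectral parameter:
$T_v(\mathrm{Ad}(\zeta)(b))\,G=G\,T_{\eta v}(b)$ (`vecRep_Ad_mul_dressingMatrix`). Both sides are
compatible with sums and products in $b$, so generators suffice.

On generators, the character $\zeta$ splits into two factors. The factor $\zeta(\omega,1)$ is
realized by conjugation with the diagonal matrix $G$: the image of $x_i$ is supported on matrix
positions $(a,b)$ for which $G_a/G_b$ has the common value $\zeta(\omega,1)(\alpha_i)$, the image of
$y_i$ on the transposed positions, and the image of $k_i$ is diagonal
(`hasDressingWeight_xMat_yMat`, `dressingMatrix_mul_qDiag`). The remaining factor is $\eta$ at node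
$0$ and $1$ elsewhere; it is a rescaling of the spectral parameter, because $v$ occurs only in the
images of $x_0$ and $y_0$, as $v$ and $v^{-1}$ (`zetaChar_eq`, `xMat_scalar_mul`,
`yMat_scalar_mul`).

Since $G$ does not depend on $u$, the same $G$ serves at $v=u$ and at $v=u^{-1}$. Substituting
$G\,T_{\eta v}(b)\,G^{-1}$ for $T_v(\mathrm{Ad}(\zeta)(b))$ in the equation for $(K,1)$ and moving
the outer factors onto $K$ gives the equation for $(G^{-1}KG,\eta)$. In the twisted case one also
needs that the antipode commutes with $\mathrm{Ad}(\zeta)$ (`antipode_Ad`) and that $G$ is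
symmetric: transposition exchanges $G$ with $G^{-1}$ on the two sides of $T_{\eta/u}$, and $K$ is
replaced by $GKG$. The two equations are equivalent for each $b$ separately, hence for any
subalgebra. -/

theorem Uq.mk_surjective (D : AffineDatum) : Function.Surjective (Uq.mk D) :=
  RingQuot.mkAlgHom_surjective KK (Rel D)

/-- A property of elements of `U_q(g)` that is closed under the algebra operations and holds for
the generators holds everywhere. -/
theorem Uq.induction {P : Uq D → Prop} (hc : ∀ t : KK, P (algebraMap KK (Uq D) t))
    (hx : ∀ i, P (Uq.mk D (x i))) (hy : ∀ i, P (Uq.mk D (y i)))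
    (hk : ∀ i, P (Uq.mk D (k i))) (hkinv : ∀ i, P (Uq.mk D (kinv i)))
    (mul : ∀ a b, P a → P b → P (a * b)) (add : ∀ a b, P a → P b → P (a + b)) (b : Uq D) :
    P b := by
  obtain ⟨a, rfl⟩ := Uq.mk_surjective D b
  induction a using FreeAlgebra.induction with
  | grade0 t => rw [AlgHom.commutes]; exact hc t
  | grade1 g =>
    cases g with
    | x i => exact hx i
    | y i => exact hy i
    | k i => exact hk i
    | kinv i => exact hkinv i
  | mul a b ha hb => rw [map_mul]; exact mul _ _ ha hb
  | add a b ha hb => rw [map_add]; exact add _ _ ha hb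

/-! ### Values of $\mathrm{Ad}(\chi)$, the antipode and $T_v$ on generators -/

section Ad
variable (χ : D.I → KKˣ) (i : D.I)
theorem Ad_x : Ad χ (Uq.mk D (x i)) = (χ i : KK) • Uq.mk D (x i) := by
  rw [Ad, Uq.lift_mk, genLift_x]
theorem Ad_y : Ad χ (Uq.mk D (y i)) = (χ i : KK)⁻¹ • Uq.mk D (y i) := by
  rw [Ad, Uq.lift_mk, genLift_y]
theorem Ad_k : Ad χ (Uq.mk D (k i)) = Uq.mk D (k i) := by
  rw [Ad, Uq.lift_mk, genLift_k]
theorem Ad_kinv : Ad χ (Uq.mk D (kinv i)) = Uq.mk D (kinv i) := by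
  rw [Ad, Uq.lift_mk, genLift_kinv]
end Ad

section antipode
variable (i : D.I)
theorem antipode_x : antipode D (Uq.mk D (x i)) = -(Uq.mk D (kinv i) * Uq.mk D (x i)) := by
  rw [antipode, antipodeHom, Uq.lift_mk, genLift_x, MulOpposite.unop_op]
theorem antipode_y : antipode D (Uq.mk D (y i)) = -(Uq.mk D (y i) * Uq.mk D (k i)) := by
  rw [antipode, antipodeHom, Uq.lift_mk, genLift_y, MulOpposite.unop_op]
theorem antipode_k : antipode D (Uq.mk D (k i)) = Uq.mk D (kinv i) := by
  rw [antipode, antipodeHom, Uq.lift_mk, genLift_k, MulOpposite.unop_op]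
theorem antipode_kinv : antipode D (Uq.mk D (kinv i)) = Uq.mk D (k i) := by
  rw [antipode, antipodeHom, Uq.lift_mk, genLift_kinv, MulOpposite.unop_op]
theorem antipode_mul (a b : Uq D) : antipode D (a * b) = antipode D b * antipode D a := by
  rw [antipode, map_mul, MulOpposite.unop_mul]; rfl
theorem antipode_add (a b : Uq D) : antipode D (a + b) = antipode D a + antipode D b := by
  rw [antipode, map_add, MulOpposite.unop_add]; rfl
theorem antipode_smul (t : KK) (a : Uq D) : antipode D (t • a) = t • antipode D a := by
  rw [antipode, map_smul, MulOpposite.unop_smul]; rfl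
theorem antipode_algebraMap (t : KK) :
    antipode D (algebraMap KK (Uq D) t) = algebraMap KK (Uq D) t := by
  rw [antipode, AlgHom.commutes]; rfl
end antipode

/-- $\mathrm{Ad}(\chi)$ scales the part of degree $\mu\in Q$ by $\chi(\mu)$, and $S$ preserves the
$Q$-degree: $k_i^{-1}x_i$ and $y_ik_i$ have the degrees of $x_i$ and $y_i$. That $S$ reverses
products does no harm, since both composites reverse them. This lets $\mathrm{Ad}(\zeta)$ be pulled
out of $T_{1/u}(S(\cdot))$ in the twisted equation. -/
theorem antipode_Ad (χ : D.I → KKˣ) (b : Uq D) : antipode D (Ad χ b) = Ad χ (antipode D b) := by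
  induction b using Uq.induction with
  | hc t => simp only [AlgHom.commutes, antipode_algebraMap]
  | hx i =>
    rw [Ad_x, antipode_smul, antipode_x, map_neg, map_mul, Ad_x, Ad_kinv, mul_smul_comm, smul_neg]
  | hy i =>
    rw [Ad_y, antipode_smul, antipode_y, map_neg, map_mul, Ad_y, Ad_k, smul_mul_assoc, smul_neg]
  | hk i => rw [Ad_k, antipode_k, Ad_kinv]
  | hkinv i => rw [Ad_kinv, antipode_kinv, Ad_k]
  | mul a b ha hb => rw [map_mul, antipode_mul, antipode_mul, map_mul, ha, hb]
  | add a b ha hb => rw [map_add, antipode_add, antipode_add, map_add, ha, hb]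

section vecRep
variable (v : KUˣ) (i : D.I)
theorem vecRep_x : vecRep D v (Uq.mk D (x i)) = xMat D v i := by
  rw [vecRep, Uq.lift_mk, genLift_x]
theorem vecRep_y : vecRep D v (Uq.mk D (y i)) = yMat D v i := by
  rw [vecRep, Uq.lift_mk, genLift_y]
theorem vecRep_k : vecRep D v (Uq.mk D (k i)) = qDiag (kExp D i) := by
  rw [vecRep, Uq.lift_mk, genLift_k]
theorem vecRep_kinv : vecRep D v (Uq.mk D (kinv i)) = qDiag (-kExp D i) := by
  rw [vecRep, Uq.lift_mk, genLift_kinv]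
end vecRep

/-! ### Weights of matrices under conjugation by $G(\omega)$ -/

variable (ω : ℕ → KKˣ)

/-- `M` has weight `z` under conjugation by `G(ω)`. -/
def HasDressingWeight (z : KKˣ) (M : Mat D) : Prop :=
  dressingMatrix D ω * M = algebraMap KK KU z • (M * dressingMatrix D ω)

namespace HasDressingWeight
variable {ω} {z : KKˣ} {M M' : Mat D}

theorem smul (h : HasDressingWeight ω z M) (t : KU) : HasDressingWeight ω z (t • M) := by
  unfold HasDressingWeight at *
  rw [mul_smul_comm, h, smul_mul_assoc, smul_comm]

theorem sub (h : HasDressingWeight ω z M) (h' : HasDressingWeight ω z M') :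
    HasDressingWeight ω z (M - M') := by
  unfold HasDressingWeight at *
  rw [mul_sub, h, h', sub_mul, smul_sub]

end HasDressingWeight

variable {ω}

/-- Conjugation by a diagonal matrix multiplies the entry at $(a,b)$ by the ratio of its diagonal
entries $G_a/G_b$. The integers $a,b$ need not be labels of basis vectors: otherwise the elementary
matrix is zero and has every weight. -/
theorem hasDressingWeight_E {z : KKˣ} {a b : ℤ}
    (h : dressingEntry D ω a = z * dressingEntry D ω b) :
    HasDressingWeight ω z (E a b : Mat D) := by
  ext r s
  simp only [dressingMatrix, Matrix.diagonal_mul, Matrix.smul_apply, Matrix.mul_diagonal, E,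
    Matrix.of_apply, smul_eq_mul]
  split_ifs with hrs
  · rw [hrs.1, hrs.2, h]; simp
  · simp

/-- In types $B,C,D$ the matrix $G(\omega)$ lies in the diagonal torus of the orthogonal or
symplectic group. This symmetry is what makes the matrices $F_{ab}$ homogeneous. The middle label
$0$, present in type $B$, carries the entry $1$. -/
theorem dressingEntry_neg (hD : D.type ≠ .A) (a : ℤ) :
    dressingEntry D ω (-a) = (dressingEntry D ω a)⁻¹ := by
  rcases lt_trichotomy a 0 with h | rfl | h
  · cases hD' : D.type <;> simp only [dressingEntry, hD'] <;> first
      | exact absurd hD' hD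
      | rw [if_neg (by omega), if_neg (by omega), if_neg (by omega), if_pos h, sub_neg_eq_add]
  · cases hD' : D.type <;> simp_all [dressingEntry]
  · cases hD' : D.type <;> simp only [dressingEntry, hD'] <;> first
      | exact absurd hD' hD
      | rw [if_neg (by omega), if_pos (by omega), if_neg (by omega), if_neg (by omega), inv_inv,
          ← sub_eq_add_neg]

/-- The two terms of $F_{ab}$ have the same weight, because $G_{-b}/G_{-a}=G_a/G_b$. The signs
$\vartheta$ are scalars and do not affect it. -/
theorem hasDressingWeight_F (hD : D.type ≠ .A) {z : KKˣ} {a b : ℤ}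
    (h : dressingEntry D ω a = z * dressingEntry D ω b) :
    HasDressingWeight ω z (F a b : Mat D) := by
  have h' : dressingEntry D ω (-b) = z * dressingEntry D ω (-a) := by
    rw [dressingEntry_neg hD, dressingEntry_neg hD, h, mul_inv_rev, mul_comm z, mul_assoc,
      inv_mul_cancel, mul_one]
  refine (hasDressingWeight_E h).sub ?_
  -- The sign $\vartheta_a\vartheta_b$ is an integer; it is read as a scalar of $\mathbb K(u)$ so
  -- that closure under scalar multiples applies.
  rw [← Int.cast_smul_eq_zsmul KU]
  exact (hasDressingWeight_E h').smul _

/-- The entry of `G(ω)` at the label `-ī`, where `ī = n + 1 - i`. -/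
theorem dressingEntry_neg_bar (hD : D.type ≠ .A) {i : ℕ} {a : ℤ} (hi : i ≤ D.n)
    (ha : a = i - D.n - 1) : dressingEntry D ω a = ω i := by
  -- The bound $i\le n$ gives $a\le -1$, which selects the branch of negative labels.
  have : (D.n + 1 + a).toNat = i := by omega
  cases hD' : D.type <;> simp only [dressingEntry, hD'] <;> first
    | exact absurd hD' hD
    | rw [if_neg (by omega), if_pos (by omega), this]

theorem dressingEntry_bar (hD : D.type ≠ .A) {i : ℕ} {a : ℤ} (hi : i ≤ D.n)
    (ha : a = D.n + 1 - i) : dressingEntry D ω a = (ω i)⁻¹ := by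
  rw [← neg_neg a, dressingEntry_neg hD, dressingEntry_neg_bar hD hi (by omega)]

theorem dressingEntry_zero (hD : D.type ≠ .A) : dressingEntry D ω 0 = 1 := by
  cases hD' : D.type <;> simp_all [dressingEntry]

theorem dressingEntry_A (hD : D.type = .A) {i : ℕ} {a : ℤ} (ha : a = i) :
    dressingEntry D ω a = ω i := by
  simp [dressingEntry, hD, ha]

/-! ### Splitting off $\eta$ as a rescaling of the spectral parameter -/

theorem zetaChar_eq (η : KKˣ) (i : D.I) :
    zetaChar D ω η i = (if (i : ℕ) = 0 then η else 1) * zetaChar D ω 1 i := by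
  unfold zetaChar
  split_ifs <;> cases D.type <;> simp [mul_assoc]

/-- The parameter $v$ enters the image of $x_0$ linearly and no other $x_i$. The factor produced is
exactly the one by which $\zeta(\omega,\eta)(\alpha_i)$ differs from $\zeta(\omega,1)(\alpha_i)$, so
$\eta$ cancels from the comparison and only $\zeta(\omega,1)$ has to be matched with conjugation by
$G(\omega)$. -/
theorem xMat_scalar_mul (η : KKˣ) (v : KUˣ) (i : D.I) :
    xMat D (scalar η * v) i =
      algebraMap KK KU ((if (i : ℕ) = 0 then η else 1 : KKˣ) : KK) • xMat D v i := by
  have : ((scalar η : KUˣ) : KU) = algebraMap KK KU η := rfl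
  cases hD : D.type <;> simp only [xMat, hD] <;> split_ifs <;>
    simp [this, smul_smul, mul_left_comm]

theorem yMat_scalar_mul (η : KKˣ) (v : KUˣ) (i : D.I) :
    yMat D (scalar η * v) i =
      (algebraMap KK KU ((if (i : ℕ) = 0 then η else 1 : KKˣ) : KK))⁻¹ • yMat D v i := by
  have : ((scalar η : KUˣ) : KU) = algebraMap KK KU η := rfl
  cases hD : D.type <;> simp only [yMat, hD] <;> split_ifs <;>
    simp [this, smul_smul, mul_comm, mul_left_comm, mul_assoc]

/-- The image of $y_i$ occupies the positions of $x_i$ transposed. Stated with the hypothesis of the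
untransposed version, this lets a single relation between entries of $G(\omega)$ settle both
generators. -/
theorem hasDressingWeight_E_inv {z : KKˣ} {a b : ℤ}
    (h : dressingEntry D ω a = z * dressingEntry D ω b) :
    HasDressingWeight ω z⁻¹ (E b a : Mat D) :=
  hasDressingWeight_E (by rw [h, inv_mul_cancel_left])

theorem hasDressingWeight_F_inv (hD : D.type ≠ .A) {z : KKˣ} {a b : ℤ}
    (h : dressingEntry D ω a = z * dressingEntry D ω b) :
    HasDressingWeight ω z⁻¹ (F b a : Mat D) :=
  hasDressingWeight_F hD (by rw [h, inv_mul_cancel_left])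

/-! ### Weights of the images of $x_i$ and $y_i$, node by node -/

theorem hasDressingWeight_A (hD : D.type = .A) (v : KUˣ) (i : D.I) :
    HasDressingWeight ω (zetaChar D ω 1 i) (xMat D v i) ∧
      HasDressingWeight ω (zetaChar D ω 1 i)⁻¹ (yMat D v i) := by
  have hi : (i : ℕ) ≤ D.n := Nat.lt_succ_iff.mp i.2
  by_cases h0 : (i : ℕ) = 0
  -- Node $0$ acts through $E_{N1}$ with $N=n+1$, so its weight is $\omega_N/\omega_1$.
  · have h : dressingEntry D ω (D.n + 1) = zetaChar D ω 1 i * dressingEntry D ω 1 := by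
      rw [dressingEntry_A hD (i := D.n + 1) (by simp), dressingEntry_A hD (i := 1) (by simp)]
      simp only [zetaChar, hD, h0, if_true, one_mul]
      rw [mul_comm _ (ω (D.n + 1)), inv_mul_cancel_right]
    simp only [xMat, yMat, hD, h0, if_true]
    exact ⟨(hasDressingWeight_E h).smul _, (hasDressingWeight_E_inv h).smul _⟩
  · have h : dressingEntry D ω (i : ℕ) = zetaChar D ω 1 i * dressingEntry D ω ((i : ℕ) + 1) := by
      rw [dressingEntry_A hD rfl, dressingEntry_A hD (i := i + 1) (by simp)]
      simp only [zetaChar, hD, h0, if_false]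
      -- In type $A$ the formula $\omega_i/\omega_{i+1}$ also holds at $i=n$; that node is separate
      -- only because the other types differ there.
      split_ifs with h
      · rw [inv_mul_cancel_right]
      · simp only [show (i : ℕ) = D.n by omega, inv_mul_cancel_right]
    simp only [xMat, yMat, hD, h0, if_false]
    exact ⟨hasDressingWeight_E h, hasDressingWeight_E_inv h⟩

/-- The inner nodes behave alike in types $B,C,D$: $x_i$ acts through
$F_{-\bar\imath,-\bar\imath+1}$, and $-\bar\imath+1$ is the negative of $\overline{i+1}$, so the
ratio of entries is $\omega_i/\omega_{i+1}$. -/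
theorem hasDressingWeight_mid (hD : D.type ≠ .A) (v : KUˣ) (i : D.I) (h0 : (i : ℕ) ≠ 0)
    (hi : (i : ℕ) < D.n) :
    HasDressingWeight ω (zetaChar D ω 1 i) (xMat D v i) ∧
      HasDressingWeight ω (zetaChar D ω 1 i)⁻¹ (yMat D v i) := by
  have h : dressingEntry D ω (-(D.n + 1 - (i : ℕ))) =
      zetaChar D ω 1 i * dressingEntry D ω (-(D.n + 1 - (i : ℕ)) + 1) := by
    rw [dressingEntry_neg_bar hD hi.le (by omega),
      -- Here $i<n$ is essential: it keeps the label $-\bar\imath+1$ negative.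
      dressingEntry_neg_bar hD (i := i + 1) (by omega) (by push_cast; ring)]
    simp only [zetaChar, h0, hi, if_false, if_true, inv_mul_cancel_right]
  cases hD' : D.type <;> simp only [xMat, yMat, hD', h0, hi, if_false, if_true] <;> first
    | exact absurd hD' hD
    | exact ⟨hasDressingWeight_F hD h, hasDressingWeight_F_inv hD h⟩

/-- The affine generator runs between opposite ends of the basis: $F_{n-1,-n}$ in types $B,D$ has
weight $\omega_2^{-1}\omega_1^{-1}$, and $F_{n,-n}$ in type $C$ has weight $\omega_1^{-2}$. -/
theorem hasDressingWeight_zero (hD : D.type ≠ .A) (v : KUˣ) (i : D.I) (h0 : (i : ℕ) = 0) :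
    HasDressingWeight ω (zetaChar D ω 1 i) (xMat D v i) ∧
      HasDressingWeight ω (zetaChar D ω 1 i)⁻¹ (yMat D v i) := by
  have hn := D.hn
  have e : D.type.minRank ≥ 1 := by cases D.type <;> decide
  have h1 : dressingEntry D ω (-D.n) = ω 1 :=
    dressingEntry_neg_bar hD (by omega) (by push_cast; ring)
  -- The assumption $n\ge2$ makes the label $n-1=\bar2$ positive. It is available in types $B$ and
  -- $D$; type $C$ allows $n=1$ and does not use this label.
  have h2 (h : 2 ≤ D.n) : dressingEntry D ω (D.n - 1) = (ω 2)⁻¹ :=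
    dressingEntry_bar hD h (by push_cast; ring)
  cases hD' : D.type
  · exact absurd hD' hD
  · have h : dressingEntry D ω (D.n - 1) = zetaChar D ω 1 i * dressingEntry D ω (-D.n) := by
      rw [h1, h2 (by simpa [hD', ClassicalType.minRank] using hn)]
      simp [zetaChar, hD', h0, mul_right_comm]
    simp only [xMat, yMat, hD', h0, if_true]
    exact ⟨(hasDressingWeight_F hD h).smul _, (hasDressingWeight_F_inv hD h).smul _⟩
  · have h : dressingEntry D ω D.n = zetaChar D ω 1 i * dressingEntry D ω (-D.n) := by
      rw [h1, dressingEntry_bar hD (i := 1) (by omega) (by push_cast; ring)]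
      simp [zetaChar, hD', h0, pow_two]
    simp only [xMat, yMat, hD', h0, if_true]
    exact ⟨(hasDressingWeight_F hD h).smul _, (hasDressingWeight_F_inv hD h).smul _⟩
  · have h : dressingEntry D ω (D.n - 1) = zetaChar D ω 1 i * dressingEntry D ω (-D.n) := by
      have : 3 ≤ D.n := by simpa [hD', ClassicalType.minRank] using hn
      rw [h1, h2 (by omega)]
      simp [zetaChar, hD', h0, mul_right_comm]
    simp only [xMat, yMat, hD', h0, if_true]
    exact ⟨(hasDressingWeight_F hD h).smul _, (hasDressingWeight_F_inv hD h).smul _⟩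

/-- The remaining node is $i=n$. With $G_{-1}=\omega_n$ and $G_1=\omega_n^{-1}$, the positions of
$x_n$ give $G_{-1}/G_0=\omega_n$ in type $B$, $G_{-1}/G_1=\omega_n^2$ in type $C$ and
$G_{-2}/G_1=\omega_{n-1}\omega_n$ in type $D$. -/
theorem hasDressingWeight_last (hD : D.type ≠ .A) (v : KUˣ) (i : D.I) (h0 : (i : ℕ) ≠ 0)
    (hi : ¬ (i : ℕ) < D.n) :
    HasDressingWeight ω (zetaChar D ω 1 i) (xMat D v i) ∧
      HasDressingWeight ω (zetaChar D ω 1 i)⁻¹ (yMat D v i) := by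
  have h1 : dressingEntry D ω (-1) = ω D.n := dressingEntry_neg_bar hD le_rfl (by ring)
  have h1' : dressingEntry D ω 1 = (ω D.n)⁻¹ := dressingEntry_bar hD le_rfl (by ring)
  cases hD' : D.type
  · exact absurd hD' hD
  · have hz : zetaChar D ω 1 i = ω D.n := by simp [zetaChar, hD', h0, hi]
    have h : dressingEntry D ω (-1) = zetaChar D ω 1 i * dressingEntry D ω 0 := by
      rw [h1, dressingEntry_zero hD, hz, mul_one]
    -- In type $B$ the powers of $q^{1/2}$ prevent $x_n$ and $y_n$ from being multiples of some
    -- $F_{ab}$, so the positions $(-1,0)$ and $(0,1)$ are treated separately. Their weights agree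
    -- because $G_0=1$ and $G_1=G_{-1}^{-1}$.
    have h' : dressingEntry D ω 0 = zetaChar D ω 1 i * dressingEntry D ω 1 := by
      rw [h1', dressingEntry_zero hD, hz, mul_inv_cancel]
    simp only [xMat, yMat, hD', h0, hi, if_false]
    exact ⟨((hasDressingWeight_E h).sub ((hasDressingWeight_E h').smul _)).smul _,
      ((hasDressingWeight_E_inv h).sub ((hasDressingWeight_E_inv h').smul _)).smul _⟩
  · have h : dressingEntry D ω (-1) = zetaChar D ω 1 i * dressingEntry D ω 1 := by
      rw [h1, h1']
      simp [zetaChar, hD', h0, hi, pow_two]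
    simp only [xMat, yMat, hD', h0, hi, if_false]
    exact ⟨(hasDressingWeight_F hD h).smul _, (hasDressingWeight_F_inv hD h).smul _⟩
  · have hn : 3 ≤ D.n := by simpa [hD', ClassicalType.minRank] using D.hn
    have h : dressingEntry D ω (-2) = zetaChar D ω 1 i * dressingEntry D ω 1 := by
      rw [h1', dressingEntry_neg_bar hD (i := D.n - 1) (by omega) (by omega)]
      simp [zetaChar, hD', h0, hi]
    simp only [xMat, yMat, hD', h0, hi, if_false]
    exact ⟨hasDressingWeight_F hD h, hasDressingWeight_F_inv hD h⟩

variable (ω) in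
/-- The images of `x_i` and `y_i` have weights `ζ(α_i)^{±1}`, where `ζ = ζ(ω, 1)`. -/
theorem hasDressingWeight_xMat_yMat (v : KUˣ) (i : D.I) :
    HasDressingWeight ω (zetaChar D ω 1 i) (xMat D v i) ∧
      HasDressingWeight ω (zetaChar D ω 1 i)⁻¹ (yMat D v i) := by
  by_cases hD : D.type = .A
  · exact hasDressingWeight_A hD v i
  by_cases h0 : (i : ℕ) = 0
  · exact hasDressingWeight_zero hD v i h0
  by_cases hi : (i : ℕ) < D.n
  · exact hasDressingWeight_mid hD v i h0 hi
  · exact hasDressingWeight_last hD v i h0 hi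

/-! ### The intertwining identity between $T_v\circ\mathrm{Ad}(\zeta)$ and $T_{\eta v}$ -/

theorem dressingMatrix_mul_qDiag (m : ℤ → ℤ) :
    dressingMatrix D ω * qDiag m = qDiag m * dressingMatrix D ω := by
  simp only [dressingMatrix, qDiag, Matrix.diagonal_mul_diagonal, mul_comm]

/-- `T_v ∘ Ad(ζ(ω, η))` is the conjugate of `T_{ηv}` by `G(ω)`. -/
theorem vecRep_Ad_mul_dressingMatrix (η : KKˣ) (v : KUˣ) (b : Uq D) :
    vecRep D v (Ad (zetaChar D ω η) b) * dressingMatrix D ω =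
      dressingMatrix D ω * vecRep D (scalar η * v) b := by
  induction b using Uq.induction with
  | hc t => simp only [AlgHom.commutes, Algebra.commutes]
  | hx i =>
    -- Both sides become $\zeta(\omega,\eta)(\alpha_i)\,T_v(x_i)\,G(\omega)$: on the right, $\eta$
    -- at node $0$ comes from the spectral parameter and $\zeta(\omega,1)(\alpha_i)$ from moving
    -- $G(\omega)$ across. For $y_i$ the scalars are inverted.
    rw [Ad_x, map_smul, vecRep_x, vecRep_x, xMat_scalar_mul, mul_smul_comm,
      (hasDressingWeight_xMat_yMat ω v i).1, zetaChar_eq, smul_smul, ← map_mul, algebraMap_smul,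
      smul_mul_assoc, Units.val_mul]
  | hy i =>
    rw [Ad_y, map_smul, vecRep_y, vecRep_y, yMat_scalar_mul, mul_smul_comm,
      (hasDressingWeight_xMat_yMat ω v i).2, zetaChar_eq, smul_smul, ← map_inv₀, ← map_mul, algebraMap_smul,
      smul_mul_assoc, Units.val_mul, mul_inv, Units.val_inv_eq_inv_val]
  | hk i => rw [Ad_k, vecRep_k, vecRep_k, dressingMatrix_mul_qDiag]
  | hkinv i => rw [Ad_kinv, vecRep_kinv, vecRep_kinv, dressingMatrix_mul_qDiag]
  -- $G(\omega)$ is carried leftwards across the image of $b$, then across that of $a$. In this form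
  -- the induction needs no inverse of $G(\omega)$.
  | mul a b ha hb => rw [map_mul, map_mul, map_mul, mul_assoc, hb, ← mul_assoc, ha, mul_assoc]
  | add a b ha hb => rw [map_add, map_add, map_add, add_mul, ha, hb, mul_add]

variable (D ω) in
theorem isUnit_dressingMatrix : IsUnit (dressingMatrix D ω) := by
  rw [Matrix.isUnit_iff_isUnit_det, dressingMatrix, Matrix.det_diagonal, IsUnit.prod_iff]
  exact fun a _ => ((dressingEntry D ω a).isUnit.map (algebraMap KK KU))

theorem vecRep_Ad_zetaChar (η : KKˣ) (v : KUˣ) (b : Uq D) :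
    vecRep D v (Ad (zetaChar D ω η) b) =
      dressingMatrix D ω * vecRep D (scalar η * v) b * (dressingMatrix D ω)⁻¹ := by
  have h := (Matrix.isUnit_iff_isUnit_det _).mp (isUnit_dressingMatrix D ω)
  rw [← vecRep_Ad_mul_dressingMatrix, Matrix.mul_nonsing_inv_cancel_right _ _ h]

/-! ### Transport of the boundary intertwining equations -/

theorem scalar_one : scalar 1 = 1 := map_one _

/-- For a fixed $b$, the equation for $(K,1)$ at $\mathrm{Ad}(\zeta)(b)$ reads $K\,G\,T_{\eta
u}(b)\,G^{-1}=G\,T_{\eta/u}(b)\,G^{-1}K$. Multiplication by $G^{-1}$ on the left and $G$ on the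
right turns it into the equation for $G^{-1}KG$ at $b$. -/
theorem isUntwistedSolution_dressing_iff (η : KKˣ) (B : Subalgebra KK (Uq D)) (K : Mat D) :
    IsUntwistedSolution B ((dressingMatrix D ω)⁻¹ * K * dressingMatrix D ω) η ↔
      IsUntwistedSolution (B.map (Ad (zetaChar D ω η))) K 1 := by
  have h := isUnit_dressingMatrix D ω
  have hd := (Matrix.isUnit_iff_isUnit_det _).mp h
  have e1 := Matrix.mul_nonsing_inv _ hd
  have e2 := Matrix.nonsing_inv_mul _ hd
  -- Elements of the image algebra are written as $\mathrm{Ad}(\zeta)(b)$ with $b\in B$, so both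
  -- conditions range over the same $b$.
  simp only [IsUntwistedSolution, Subalgebra.mem_map, forall_exists_index, and_imp,
    forall_apply_eq_imp_iff₂, scalar_one, one_mul, vecRep_Ad_zetaChar]
  refine forall₂_congr fun b _ => ?_
  -- The equation for $G^{-1}KG$ is multiplied by $G$ on the left, the one for $K$ by $G$ on the
  -- right. Both then read $K\,G\,T_{\eta u}(b)=G\,T_{\eta/u}(b)\,G^{-1}KG$.
  rw [← h.mul_right_inj, ← h.mul_left_inj (b := K * _)]
  -- Two passes are needed: bracketing to the right exposes the product $G^{-1}G$ at the right end
  -- of a word, bracketing to the left the product $GG^{-1}$ at the left end.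
  simp only [mul_assoc, e2, mul_one]
  simp only [← mul_assoc, e1, one_mul]

/-- As $S$ commutes with $\mathrm{Ad}(\zeta)$ and $G^{\rm t}=G$, the equation for $(K,1)$ at
$\mathrm{Ad}(\zeta)(b)$ reads $K\,G\,T_{\eta u}(b)\,G^{-1}=G^{-1}\,T_{\eta/u}(S(b))^{\rm t}\,G\,K$.
Now $G^{-1}$ is the outer factor on both sides, whence $GKG$ instead of a conjugate of $K$. -/
theorem isTwistedSolution_dressing_iff (η : KKˣ) (B : Subalgebra KK (Uq D)) (K : Mat D) :
    IsTwistedSolution B (dressingMatrix D ω * K * dressingMatrix D ω) η ↔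
      IsTwistedSolution (B.map (Ad (zetaChar D ω η))) K 1 := by
  have h := isUnit_dressingMatrix D ω
  have hd := (Matrix.isUnit_iff_isUnit_det _).mp h
  have e1 := Matrix.mul_nonsing_inv _ hd
  have e2 := Matrix.nonsing_inv_mul _ hd
  have ht : (dressingMatrix D ω).transpose = dressingMatrix D ω := Matrix.diagonal_transpose _
  simp only [IsTwistedSolution, Subalgebra.mem_map, forall_exists_index, and_imp,
    forall_apply_eq_imp_iff₂, scalar_one, one_mul, antipode_Ad, vecRep_Ad_zetaChar,
    Matrix.transpose_mul, Matrix.transpose_nonsing_inv, ht]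
  refine forall₂_congr fun b _ => ?_
  -- Only the equation for $K$ is changed: it is multiplied by $G$ on both sides, which clears the
  -- outer inverses and produces the equation for $GKG$.
  rw [← h.mul_right_inj (b := K * _), ← h.mul_left_inj (b := _ * (K * _))]
  simp only [mul_assoc, e2, mul_one]
  simp only [← mul_assoc, e1, one_mul]

end dressing

end QAff

open QAff

theorem mainTheorem8 (D : AffineDatum) (ω : ℕ → KKˣ) (hω : IsDressing D ω) (η : KKˣ)
    (X : Finset D.I) (τ : Equiv.Perm D.I) (w : List D.I) (hw : IsLongestWord D X w)
    (hXτ : IsGSat D X τ w) (Istar : Finset D.I) (hIstar : IsTransversal X τ Istar)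
    (c : D.I → KKˣ) (hc : c ∈ paramC D τ w Istar)
    (s : D.I → KK) (hs : s ∈ paramS D X τ Istar) (K : Mat D) :
    (IsUntwistedSolution (quantumPair X τ w c s)
        ((dressingMatrix D ω)⁻¹ * K * dressingMatrix D ω) η ↔
      IsUntwistedSolution ((quantumPair X τ w c s).map (Ad (zetaChar D ω η))) K 1) ∧
    (IsTwistedSolution (quantumPair X τ w c s)
        (dressingMatrix D ω * K * dressingMatrix D ω) η ↔
      IsTwistedSolution ((quantumPair X τ w c s).map (Ad (zetaChar D ω η))) K 1) := by
  exact ⟨isUntwistedSolution_dressing_iff η _ K, isTwistedSolution_dressing_iff η _ K⟩
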